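/- **Conventions.** "Directed colimits" are colimits of diagrams indexed by nonempty directed posets. An *independence relation* $\perp$ on a category $\mathcal X$ is a class of commuting squares. We write $A\perp_C^M B$ when the commuting square $C\to A\to M$, $C\to B\to M$ (with $C \to A$ on the left, $C\to B$ at the bottom) is in the class. All diagrams below are in $\mathcal X$ and commute. Properties of $\perp$: - *Invariance*: for $M\to N$, $A\perp_C^M B$ iff $A\perp_C^N B$. *Semi-invariance*: for $M\to N$, $A\perp_C^N B$ implies $A\perp_C^M B$. - *Monotonicity*: for $C\to B'\to B$, $A\perp_C^M B$ implies $A\perp_C^M B'$. - *Transitivity*: $A\perp_C^M B$ and $M\perp_B^N D$ imply $A\perp_C^N D$. - *Symmetry*: $A\perp_C^M B$ iff $B\perp_C^M A$. - *Basic existence*: commuting squares whose left or bottom morphism is an isomorphism are independent (this follows from existence and invariance). - *Existence*: every span $A\leftarrow C\to B$ can be completed to an independent square. - *Base monotonicity*: if $A\perp_C^M D$ and $C\to D$ factors as $C\to B\to D$, there are $A\to A'\leftarrow B$ and $A'\to N\leftarrow M$ making everything commute with $A'\perp_B^N D$. - *Uniqueness*: if $A\perp_C^M B$ and $A\perp_C^{M'}B$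 with the same span $A\leftarrow C\to B$, there are $M\to N\leftarrow M'$ such that the two composites $A\to N$ agree and the two composites $B\to N$ agree. - *$3$-amalgamation*: given independent squares $A\perp_M^{N_1}B$, $A\perp_M^{N_2}C$, $C\perp_M^{N_3}B$ sharing the morphisms from $M$, there are $N_i\to N$ ($i=1,2,3$) completing them to a commuting cube with $A\perp_M^N N_3$. *Strong $3$-amalgamation*: moreover the cube can be chosen with all faces independent, i.e. also $N_2\perp_A^N N_1$, $N_1\perp_B^N N_3$ and $N_2\perp_C^N N_3$. - If $\perp$ has basic existence and transitivity, let $\mathcal X_\perp$ be the category whose objects are the morphisms of $\mathcal X$ and whose morphisms $(C\to A)\to(B\to M)$ are the squares with $A\perp_C^M B$; it is a subcategory of the category $\mathcal X^2$ of morphisms and commuting squares. $\perp$ is *accessible* if $\mathcal X_\perp$ is an accessible category, and has *union* if $\mathcal X_\perp$ has directed colimits and the inclusion into $\mathcal X^2$ preserves them. $\perp$ is *NSOP$_1$-like* if it is accessible and satisfies invariance, monotonicity, transitivity, symmetry, existence, $3$-amalgamation and union; *simple* if it is NSOP$_1$-like and satisfies base monotonicity; *stable* if it is simple and satisfies uniqueness.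 For a class $\mathcal M$ of morphisms of $\mathcal D$ that is *composable* (closed under composition and containing all isomorphisms), $\mathcal D_{\mathcal M}$ is the subcategory of $\mathcal D$ with all objects and with the morphisms in $\mathcal M$. $\mathcal M$ is *left-cancellable* if $gf\in\mathcal M$ implies $f\in\mathcal M$, *accessible* if $\mathcal D_{\mathcal M}$ is an accessible category, and *continuous* if $\mathcal D_{\mathcal M}$ is closed under directed colimits in $\mathcal D$ (the colimit coprojections in $\mathcal D$ of a directed diagram in $\mathcal D_{\mathcal M}$, and the maps out of the colimit induced by cocones in $\mathcal D_{\mathcal M}$, are in $\mathcal M$). A functor $F:\mathcal C\to\mathcal D$ is a *left multiadjoint* if for every object $D$ of $\mathcal D$ there is a family $\{e_i:F(C_i)\to D\}_{i\in I}$ such that for every $e:F(C)\to D$ there are a unique $i\in I$ and a unique $f:C\to C_i$ with $e_iF(f)=e$. **Theorem.** Let $\mathcal C$ and $\mathcal D$ be accessible categories with directed colimits, let $F:\mathcal C\to\mathcal D$ be a faithful left multiadjoint, and let $\mathcal M$ be a left-cancellable, composable, accessible and continuous class of monomorphisms in $\mathcal D$. Let $F^{-1}(\mathcal M)$ be the class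 of morphisms $f$ of $\mathcal C$ with $F(f)\in\mathcal M$. Let $\perp$ be an independence relation on $\mathcal D_{\mathcal M}$ which, viewed as the same class of squares in $\mathcal D$, satisfies semi-invariance on $\mathcal D$. Let $F^{-1}(\perp)$ be the independence relation on $\mathcal C_{F^{-1}(\mathcal M)}$ consisting of the commuting squares whose image under the restricted functor $F:\mathcal C_{F^{-1}(\mathcal M)}\to\mathcal D_{\mathcal M}$ is in $\perp$. 1. If $\perp$ is stable, then $F^{-1}(\perp)$ is stable. 2. If $\perp$ is simple, $\mathcal C_{F^{-1}(\mathcal M)}$ and $\mathcal D_{\mathcal M}$ have binary joins of subobjects, and $F:\mathcal C_{F^{-1}(\mathcal M)}\to\mathcal D_{\mathcal M}$ preserves those joins, then $F^{-1}(\perp)$ is simple. 3. If $\perp$ is NSOP$_1$-like, then $F^{-1}(\perp)$ is NSOP$_1$-like; if in addition $\perp$ satisfies strong $3$-amalgamation, then so does $F^{-1}(\perp)$. -/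

import Mathlib

open CategoryTheory CategoryTheory.Limits

universe w v v₁ v₂ u u₁ u₂

section DirectedColimits

/-- `𝒞` has all colimits of diagrams indexed by (nonempty) directed posets in `Type w`. -/
def HasDirectedColimits (𝒞 : Type u) [Category.{v} 𝒞] : Prop :=
  ∀ (J : Type w) [PartialOrder J] [IsDirectedOrder J] [Nonempty J], HasColimitsOfShape J 𝒞

/-- `F` preserves colimits of diagrams indexed by (nonempty) directed posets in `Type w`. -/
def PreservesDirectedColimits {𝒞 : Type u₁} [Category.{v₁} 𝒞] {𝒟 : Type u₂} [Category.{v₂} 𝒟]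
    (F : 𝒞 ⥤ 𝒟) : Prop :=
  ∀ (J : Type w) [PartialOrder J] [IsDirectedOrder J] [Nonempty J], PreservesColimitsOfShape J F

end DirectedColimits

/-- An independence relation on `𝒞` is a class of commuting squares. For morphisms `ca : C ⟶ A`,
`cb : C ⟶ B`, `am : A ⟶ M`, `bm : B ⟶ M`, the proposition `Indep ca cb am bm` says that the square
```
A --am--> M
^         ^
ca        bm
|         |
C --cb--> B
```
commutes and is independent, i.e. that `A` is independent from `B` over `C` in `M`. -/
structure IndependenceRelation (𝒞 : Type u) [Category.{v} 𝒞] where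
  Indep : ∀ {C A B M : 𝒞}, (C ⟶ A) → (C ⟶ B) → (A ⟶ M) → (B ⟶ M) → Prop
  comm : ∀ {C A B M : 𝒞} {ca : C ⟶ A} {cb : C ⟶ B} {am : A ⟶ M} {bm : B ⟶ M},
    Indep ca cb am bm → ca ≫ am = cb ≫ bm

namespace IndependenceRelation

variable {𝒞 : Type u} [Category.{v} 𝒞] (I : IndependenceRelation 𝒞)

def Invariance : Prop :=
  ∀ {C A B M N : 𝒞} (ca : C ⟶ A) (cb : C ⟶ B) (am : A ⟶ M) (bm : B ⟶ M) (mn : M ⟶ N),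
    ca ≫ am = cb ≫ bm → (I.Indep ca cb am bm ↔ I.Indep ca cb (am ≫ mn) (bm ≫ mn))

/-- Only the outer square is assumed independent; the conclusion is about the inner one. -/
def SemiInvariance : Prop :=
  ∀ {C A B M N : 𝒞} (ca : C ⟶ A) (cb : C ⟶ B) (am : A ⟶ M) (bm : B ⟶ M) (mn : M ⟶ N),
    ca ≫ am = cb ≫ bm → I.Indep ca cb (am ≫ mn) (bm ≫ mn) → I.Indep ca cb am bm

def Monotonicity : Prop :=
  ∀ {C A B' B M : 𝒞} (ca : C ⟶ A) (cb' : C ⟶ B') (b'b : B' ⟶ B) (am : A ⟶ M) (bm : B ⟶ M),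
    I.Indep ca (cb' ≫ b'b) am bm → I.Indep ca cb' am (b'b ≫ bm)

/-- Independent squares can be composed horizontally. -/
def Transitivity : Prop :=
  ∀ {C A B M D N : 𝒞} (ca : C ⟶ A) (cb : C ⟶ B) (am : A ⟶ M) (bm : B ⟶ M)
    (bd : B ⟶ D) (mn : M ⟶ N) (dn : D ⟶ N),
    I.Indep ca cb am bm → I.Indep bm bd mn dn → I.Indep ca (cb ≫ bd) (am ≫ mn) dn

def Symmetry : Prop :=
  ∀ {C A B M : 𝒞} (ca : C ⟶ A) (cb : C ⟶ B) (am : A ⟶ M) (bm : B ⟶ M),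
    I.Indep ca cb am bm ↔ I.Indep cb ca bm am

/-- Commuting squares whose left or bottom morphism is an isomorphism are independent. -/
def BasicExistence : Prop :=
  ∀ {C A B M : 𝒞} (ca : C ⟶ A) (cb : C ⟶ B) (am : A ⟶ M) (bm : B ⟶ M),
    ca ≫ am = cb ≫ bm → (IsIso ca ∨ IsIso cb) → I.Indep ca cb am bm

/-- Any span can be completed to an independent square. -/
def Existence : Prop :=
  ∀ {C A B : 𝒞} (ca : C ⟶ A) (cb : C ⟶ B),
    ∃ (M : 𝒞) (am : A ⟶ M) (bm : B ⟶ M), I.Indep ca cb am bm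

/-- If `A` is independent from `D` over `C` in `M`, and `C ⟶ D` factors through `B`, then there are
`A'` and `N` (with all the evident maps) such that `A'` is independent from `D` over `B` in `N`. -/
def BaseMonotonicity : Prop :=
  ∀ {C A B D M : 𝒞} (ca : C ⟶ A) (cb : C ⟶ B) (bd : B ⟶ D) (am : A ⟶ M) (dm : D ⟶ M),
    I.Indep ca (cb ≫ bd) am dm →
    ∃ (A' N : 𝒞) (aa' : A ⟶ A') (ba' : B ⟶ A') (a'n : A' ⟶ N) (mn : M ⟶ N),
      ca ≫ aa' = cb ≫ ba' ∧ aa' ≫ a'n = am ≫ mn ∧ ba' ≫ a'n = bd ≫ dm ≫ mn ∧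
      I.Indep ba' bd a'n (dm ≫ mn)

/-- Any two independent squares with the same base span can be amalgamated. -/
def Uniqueness : Prop :=
  ∀ {C A B M M' : 𝒞} (ca : C ⟶ A) (cb : C ⟶ B) (am : A ⟶ M) (bm : B ⟶ M)
    (am' : A ⟶ M') (bm' : B ⟶ M'),
    I.Indep ca cb am bm → I.Indep ca cb am' bm' →
    ∃ (N : 𝒞) (mn : M ⟶ N) (m'n : M' ⟶ N), am ≫ mn = am' ≫ m'n ∧ bm ≫ mn = bm' ≫ m'n

/-- The three squares with corner `M` formed by the given morphisms, opposite to `N₁`, `N₂`, `N₃`,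
are independent: this is an independent horn. -/
def IsIndependentHorn {M A B C N₁ N₂ N₃ : 𝒞} (ma : M ⟶ A) (mb : M ⟶ B) (mc : M ⟶ C)
    (an₁ : A ⟶ N₁) (bn₁ : B ⟶ N₁) (an₂ : A ⟶ N₂) (cn₂ : C ⟶ N₂)
    (bn₃ : B ⟶ N₃) (cn₃ : C ⟶ N₃) : Prop :=
  I.Indep ma mb an₁ bn₁ ∧ I.Indep ma mc an₂ cn₂ ∧ I.Indep mc mb cn₃ bn₃

/-- Any independent horn can be completed to a commuting cube in which `A` is independent from
`N₃` over `M` in `N`. -/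
def ThreeAmalgamation : Prop :=
  ∀ {M A B C N₁ N₂ N₃ : 𝒞} (ma : M ⟶ A) (mb : M ⟶ B) (mc : M ⟶ C)
    (an₁ : A ⟶ N₁) (bn₁ : B ⟶ N₁) (an₂ : A ⟶ N₂) (cn₂ : C ⟶ N₂) (bn₃ : B ⟶ N₃) (cn₃ : C ⟶ N₃),
    I.IsIndependentHorn ma mb mc an₁ bn₁ an₂ cn₂ bn₃ cn₃ →
    ∃ (N : 𝒞) (n₁ : N₁ ⟶ N) (n₂ : N₂ ⟶ N) (n₃ : N₃ ⟶ N),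
      an₁ ≫ n₁ = an₂ ≫ n₂ ∧ bn₁ ≫ n₁ = bn₃ ≫ n₃ ∧ cn₂ ≫ n₂ = cn₃ ≫ n₃ ∧
      I.Indep ma (mb ≫ bn₃) (an₁ ≫ n₁) n₃

/-- Any independent horn can be completed to an independent cube, that is, to a commuting cube all
of whose faces are independent. -/
def StrongThreeAmalgamation : Prop :=
  ∀ {M A B C N₁ N₂ N₃ : 𝒞} (ma : M ⟶ A) (mb : M ⟶ B) (mc : M ⟶ C)
    (an₁ : A ⟶ N₁) (bn₁ : B ⟶ N₁) (an₂ : A ⟶ N₂) (cn₂ : C ⟶ N₂) (bn₃ : B ⟶ N₃) (cn₃ : C ⟶ N₃),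
    I.IsIndependentHorn ma mb mc an₁ bn₁ an₂ cn₂ bn₃ cn₃ →
    ∃ (N : 𝒞) (n₁ : N₁ ⟶ N) (n₂ : N₂ ⟶ N) (n₃ : N₃ ⟶ N),
      I.Indep an₂ an₁ n₂ n₁ ∧ I.Indep bn₁ bn₃ n₁ n₃ ∧ I.Indep cn₂ cn₃ n₂ n₃

/-- The class of independent squares, seen as a class of morphisms in the category `Arrow 𝒞` of
morphisms and commuting squares of `𝒞`. -/
def squares : MorphismProperty (Arrow 𝒞) :=
  fun f g sq => I.Indep f.hom sq.left sq.right g.hom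

theorem squares_isMultiplicative (hb : I.BasicExistence) (ht : I.Transitivity) :
    I.squares.IsMultiplicative where
  id_mem f := hb _ _ _ _ (by simp) (Or.inr (by dsimp; infer_instance))
  comp_mem f g hf hg := ht _ _ _ _ _ _ _ hf hg

/-- The subcategory of `Arrow 𝒞` whose morphisms are the independent squares. -/
abbrev SquareCategory (hb : I.BasicExistence) (ht : I.Transitivity) : Type (max u v) :=
  letI := I.squares_isMultiplicative hb ht
  WideSubcategory I.squares

/-- The inclusion of the category of independent squares into `Arrow 𝒞`. -/
abbrev squareInclusion (hb : I.BasicExistence) (ht : I.Transitivity) :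
    I.SquareCategory hb ht ⥤ Arrow 𝒞 :=
  letI := I.squares_isMultiplicative hb ht
  wideSubcategoryInclusion I.squares

/-- The category of independent squares is accessible (basic existence and transitivity are part of
the property, since they are what makes it a category). -/
def Accessible : Prop :=
  ∃ (hb : I.BasicExistence) (ht : I.Transitivity),
    IsAccessibleCategory.{w} (I.SquareCategory hb ht)

/-- The category of independent squares has directed colimits, and these are preserved by the
inclusion into `Arrow 𝒞`. -/
def Union : Prop :=
  ∃ (hb : I.BasicExistence) (ht : I.Transitivity),
    HasDirectedColimits.{w} (I.SquareCategory hb ht) ∧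
    PreservesDirectedColimits.{w} (I.squareInclusion hb ht)

structure IsNSOP1Like : Prop where
  accessible : Accessible.{w} I
  invariance : I.Invariance
  monotonicity : I.Monotonicity
  transitivity : I.Transitivity
  symmetry : I.Symmetry
  existence : I.Existence
  threeAmalgamation : I.ThreeAmalgamation
  union : Union.{w} I

structure IsSimple : Prop extends IsNSOP1Like.{w} I where
  baseMonotonicity : I.BaseMonotonicity

structure IsStable : Prop extends IsSimple.{w} I where
  uniqueness : I.Uniqueness

end IndependenceRelation

section Classes

variable {𝒟 : Type u} [Category.{v} 𝒟] (ℳ : MorphismProperty 𝒟)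

/-- If `g ∘ f` is in the class, then so is `f`. -/
def LeftCancellable : Prop :=
  ∀ {X Y Z : 𝒟} (f : X ⟶ Y) (g : Y ⟶ Z), ℳ (f ≫ g) → ℳ f

/-- The subcategory of `𝒟` with all objects and with the morphisms in `ℳ` is closed under directed
colimits in `𝒟`: for a directed diagram in the subcategory, with colimit cocone `c` in `𝒟`, the
coprojections are in `ℳ`, and so is the map induced by any cocone in the subcategory. -/
def IsContinuousClass [ℳ.IsMultiplicative] : Prop :=
  ∀ (J : Type w) [PartialOrder J] [IsDirectedOrder J] [Nonempty J] (G : J ⥤ WideSubcategory ℳ)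
    (c : Cocone (G ⋙ wideSubcategoryInclusion ℳ)) (hc : IsColimit c),
    (∀ j, ℳ (c.ι.app j)) ∧
    ∀ s : Cocone G, ℳ (hc.desc ((wideSubcategoryInclusion ℳ).mapCocone s))

variable {ℳ} in
/-- An independence relation on the subcategory given by `ℳ`, seen as an independence relation
on `𝒟`: it consists of the same squares. -/
def IndependenceRelation.extend [ℳ.IsMultiplicative]
    (I : IndependenceRelation (WideSubcategory ℳ)) : IndependenceRelation 𝒟 where
  Indep {C A B M} ca cb am bm :=
    ∃ (hca : ℳ ca) (hcb : ℳ cb) (ham : ℳ am) (hbm : ℳ bm),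
      I.Indep (C := ⟨C⟩) (A := ⟨A⟩) (B := ⟨B⟩) (M := ⟨M⟩) ⟨ca, hca⟩ ⟨cb, hcb⟩ ⟨am, ham⟩ ⟨bm, hbm⟩
  comm := by
    rintro C A B M ca cb am bm ⟨hca, hcb, ham, hbm, h⟩
    exact congrArg InducedWideCategory.Hom.hom (I.comm h)

end Classes

section Functors

variable {𝒞 : Type u₁} [Category.{v₁} 𝒞] {𝒟 : Type u₂} [Category.{v₂} 𝒟]

/-- For every object `D` there is a family `e i : F (X i) ⟶ D` such that every `F A ⟶ D` factors as
`e i ∘ F f` for a unique index `i` and a unique `f : A ⟶ X i`. (Distinct indices give distinct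
pairs `(X i, e i)`, so the universe of the index type is no restriction.) -/
def IsLeftMultiadjoint (F : 𝒞 ⥤ 𝒟) : Prop :=
  ∀ D : 𝒟, ∃ (ι : Type (max u₁ v₂)) (X : ι → 𝒞) (e : ∀ i, F.obj (X i) ⟶ D),
    ∀ (A : 𝒞) (a : F.obj A ⟶ D), ∃! p : Σ i, (A ⟶ X i), F.map p.2 ≫ e p.1 = a

/-- The lift of an independence relation along a functor: a commuting square is independent if and
only if its image is. -/
def IndependenceRelation.lift (F : 𝒞 ⥤ 𝒟) (I : IndependenceRelation 𝒟) :
    IndependenceRelation 𝒞 where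
  Indep ca cb am bm := ca ≫ am = cb ≫ bm ∧ I.Indep (F.map ca) (F.map cb) (F.map am) (F.map bm)
  comm h := h.1

/-- The restriction of `F` to a functor from the subcategory of `𝒞` given by the preimage of `ℳ`
to the subcategory of `𝒟` given by `ℳ`. -/
def restrictToClass (F : 𝒞 ⥤ 𝒟) (ℳ : MorphismProperty 𝒟) [ℳ.IsMultiplicative] :
    WideSubcategory (ℳ.inverseImage F) ⥤ WideSubcategory ℳ where
  obj X := ⟨F.obj X.obj⟩
  map f := ⟨F.map f.hom, f.property⟩
  map_id X := WideSubcategory.hom_ext _ (F.map_id X.obj)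
  map_comp f g := WideSubcategory.hom_ext _ (F.map_comp f.hom g.hom)

/-- The subobject represented by `j` is the join of the subobjects represented by `a` and `b`. -/
structure IsJoin {A B J X : 𝒞} (a : A ⟶ X) (b : B ⟶ X) (j : J ⟶ X) : Prop where
  mono_left : Mono a
  mono_right : Mono b
  mono_join : Mono j
  isLUB : IsLUB {Subobject.mk a, Subobject.mk b} (Subobject.mk j)

variable (𝒞) in
/-- Any two subobjects of any object have a join. -/
def HasBinaryJoinsOfSubobjects : Prop :=
  ∀ (X : 𝒞) (A B : Subobject X), ∃ J : Subobject X, IsLUB {A, B} J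

/-- `F` sends joins of two subobjects to joins of subobjects. -/
def PreservesBinaryJoinsOfSubobjects (F : 𝒞 ⥤ 𝒟) : Prop :=
  ∀ {A B J X : 𝒞} (a : A ⟶ X) (b : B ⟶ X) (j : J ⟶ X),
    IsJoin a b j → IsJoin (F.map a) (F.map b) (F.map j)

end Functors

-- Invariance, monotonicity, transitivity and symmetry concern squares that already exist, so they
-- pull back along any functor. Existence, uniqueness and (strong) 3-amalgamation ask for a new
-- apex. Such a problem is solved in `𝒟`, with some apex `D`. The multiadjoint then supplies `e : F
-- X ⟶ D` that is locally universal: every `F B ⟶ D` connected to it through a commuting shape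
-- factors uniquely through it (`IsLeftMultiadjoint.exists_isLocallyUniversal`). All edges into `D`
-- thus come from edges into one object `X` of `𝒞`, and uniqueness makes the lifted diagram commute.
-- Left-cancellability puts the lifted edges in `F⁻¹(ℳ)`. Semi-invariance removes `e` from the
-- independent squares, although `e` itself need not lie in `ℳ`.
--
-- Base monotonicity has no such direct argument, because it introduces an object `A'` of `𝒟` that
-- sits in the middle of the diagram. In the stable case it follows from existence, transitivity and
-- uniqueness. In the simple case the join of `A` and `B` inside `M` serves as `A'`.
--
-- For accessibility and union, the category of lifted independent squares is the pseudo-pullback of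
-- `Arrow 𝒞 ⥤ Arrow 𝒟` and the inclusion of the independent squares of `𝒟`
-- (`isPseudoPullback_lift`). Both functors preserve directed colimits; for a left multiadjoint this
-- again comes from local universality. Hence directed colimits in the pseudo-pullback are computed
-- in the corners, which gives union once continuity of `F⁻¹(ℳ)` is used.
--
-- Accessibility of the pseudo-pullback is proved by a closing-off argument. The two projections of
-- an object are written as colimits of presentable objects over one common poset `W`. The
-- comparison isomorphism in the base and its inverse are represented by maps between terms of the
-- two diagrams. Over a small subset of `W` closed under the finitely many indices that these maps
-- and their identities require, the comparison restricts to an isomorphism of subcolimits, so the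
-- pair of subcolimits is an object of the pseudo-pullback. The closed subsets form a `lam`-filtered
-- poset, and the original object is the colimit over it. Since all directed colimits exist, any
-- large enough regular `lam` works.

universe v₃ v₄ u₃ u₄

/-! ### Small subsets closed under a finite-set-valued operation -/

section ClosedSubsets

variable {W : Type w}

/-- A subset of `W` closed under the (finite-)set-valued operation `Φ`. -/
def IsClosedUnderOp (Φ : W → W → Set W) (U : Set W) : Prop :=
  ∀ a ∈ U, ∀ b ∈ U, Φ a b ⊆ U

variable {lam : Cardinal.{w}} [Fact lam.IsRegular]

/-- One step of the closure of a subset under the operation `Φ`. -/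
def closureStep (Φ : W → W → Set W) (X : Set W) : Set W :=
  X ∪ ⋃ p : X × X, Φ p.1 p.2

lemma hasCardinalLT_closureStep (Φ : W → W → Set W) (hΦ : ∀ a b, (Φ a b).Finite)
    {X : Set W} (hX : HasCardinalLT X lam) : HasCardinalLT (closureStep Φ X) lam := by
  have h0 : Cardinal.aleph0 ≤ lam := Cardinal.IsRegular.aleph0_le Fact.out
  refine hasCardinalLT_union h0 hX (hasCardinalLT_iUnion _ (hasCardinalLT_prod h0 hX hX) ?_)
  intro p
  have := (hΦ p.1 p.2).to_subtype
  exact hasCardinalLT_of_finite _ _ h0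

/-- One step of closure keeps the size below `lam`, and countably many steps suffice because `Φ`
takes two arguments. Uncountability of `lam` is what keeps the union of the steps small. -/
lemma exists_closed_superset (hlam : Cardinal.aleph0 < lam) (Φ : W → W → Set W)
    (hΦ : ∀ a b, (Φ a b).Finite) (X : Set W) (hX : HasCardinalLT X lam) :
    ∃ U : Set W, X ⊆ U ∧ HasCardinalLT U lam ∧ IsClosedUnderOp Φ U := by
  let Y : ℕ → Set W := fun n => (closureStep Φ)^[n] X
  have hY : Monotone Y := monotone_nat_of_le_succ fun n => by
    simp only [Y, Function.iterate_succ_apply']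
    exact Set.subset_union_left
  refine ⟨⋃ n, Y n, Set.subset_iUnion Y 0, hasCardinalLT_iUnion _ ?_ ?_, ?_⟩
  · simpa [HasCardinalLT] using hlam
  · intro n
    induction n with
    | zero => exact hX
    | succ n ih =>
      simp only [Y, Function.iterate_succ_apply']
      exact hasCardinalLT_closureStep Φ hΦ ih
  · intro a ha b hb c hc
    obtain ⟨n, hn⟩ := Set.mem_iUnion.1 ha
    obtain ⟨m, hm⟩ := Set.mem_iUnion.1 hb
    refine Set.mem_iUnion.2 ⟨max n m + 1, ?_⟩
    simp only [Y, Function.iterate_succ_apply']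
    exact Or.inr (Set.mem_iUnion.2
      ⟨⟨⟨a, hY (le_max_left _ _) hn⟩, ⟨b, hY (le_max_right _ _) hm⟩⟩, hc⟩)

variable (lam) in
/-- The poset of nonempty subsets of cardinality `< lam` that are closed under `Φ`. -/
@[ext]
structure SmallClosed (Φ : W → W → Set W) : Type w where
  carrier : Set W
  nonempty : carrier.Nonempty
  hasCardinalLT : HasCardinalLT carrier lam
  closed : IsClosedUnderOp Φ carrier

namespace SmallClosed

variable {Φ : W → W → Set W}

instance : PartialOrder (SmallClosed lam Φ) :=
  PartialOrder.lift carrier fun _ _ => SmallClosed.ext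

lemma exists_superset (hlam : Cardinal.aleph0 < lam) (hΦ : ∀ a b, (Φ a b).Finite)
    (X : Set W) (hX : HasCardinalLT X lam) (hX' : X.Nonempty) :
    ∃ U : SmallClosed lam Φ, X ⊆ U.carrier := by
  obtain ⟨U, hU, hU', hU''⟩ := exists_closed_superset hlam Φ hΦ X hX
  exact ⟨⟨U, hX'.mono hU, hU', hU''⟩, hU⟩

lemma exists_mem (hlam : Cardinal.aleph0 < lam) (hΦ : ∀ a b, (Φ a b).Finite) (x : W) :
    ∃ U : SmallClosed lam Φ, x ∈ U.carrier := by
  obtain ⟨U, hU⟩ := exists_superset hlam hΦ {x} (hasCardinalLT_of_finite _ _ hlam.le)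
    (Set.singleton_nonempty x)
  exact ⟨U, hU rfl⟩

lemma isCardinalFiltered [Nonempty W] (hlam : Cardinal.aleph0 < lam)
    (hΦ : ∀ a b, (Φ a b).Finite) : IsCardinalFiltered (SmallClosed lam Φ) lam := by
  refine isCardinalFiltered_preorder _ _ fun K s hK => ?_
  let w₀ : W := Classical.arbitrary W
  -- The extra point `w₀` keeps the set nonempty when the family is empty.
  obtain ⟨U, hU⟩ := exists_superset (Φ := Φ) hlam hΦ ((⋃ k, (s k).carrier) ∪ {w₀})
    (hasCardinalLT_union hlam.le
      (hasCardinalLT_iUnion _ ((hasCardinalLT_iff_cardinal_mk_lt _ _).2 hK)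
        fun k => (s k).hasCardinalLT)
      (hasCardinalLT_of_finite _ _ hlam.le)) ⟨w₀, Or.inr rfl⟩
  exact ⟨U, fun k => (Set.subset_iUnion (fun k => (s k).carrier) k).trans
    (Set.subset_union_left.trans hU)⟩

instance (U : SmallClosed lam Φ) : Nonempty U.carrier := U.nonempty.to_subtype

omit [Fact lam.IsRegular] in
lemma mem_of_hom {U V : SmallClosed lam Φ} (i : U ⟶ V) {x : W} (hx : x ∈ U.carrier) :
    x ∈ V.carrier :=
  leOfHom i hx

-- The operation `Φ` always offers an upper bound of its arguments, so closed subsets are directed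
-- and colimits over them are directed colimits.
omit [Fact lam.IsRegular] in
lemma isDirectedOrder [PartialOrder W] (hub : ∀ a b, ∃ c ∈ Φ a b, a ≤ c ∧ b ≤ c)
    (U : SmallClosed lam Φ) : IsDirectedOrder U.carrier where
  directed a b := by
    obtain ⟨c, hc, hac, hbc⟩ := hub a.1 b.1
    exact ⟨⟨c, U.closed _ a.2 _ b.2 hc⟩, hac, hbc⟩

end SmallClosed

lemma hasCardinalLT_arrow_of_preorder (J : Type w) [Preorder J] (hJ : HasCardinalLT J lam) :
    HasCardinalLT (Arrow J) lam := by
  refine (hasCardinalLT_prod (Cardinal.IsRegular.aleph0_le Fact.out) hJ hJ).of_injective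
    (fun f : Arrow J => (f.left, f.right)) ?_
  rintro ⟨a, b, f⟩ ⟨a', b', f'⟩ h
  simp only [Prod.mk.injEq] at h
  obtain ⟨rfl, rfl⟩ := h
  obtain rfl : f = f' := Subsingleton.elim _ _
  rfl

end ClosedSubsets

/-! ### Colimits of a diagram over small closed subsets -/

section SubsetColimits

variable {W : Type w} [PartialOrder W] {lam : Cardinal.{w}} [Fact lam.IsRegular]
  {Φ : W → W → Set W} {A : Type u} [Category.{v} A] {B : Type u₁} [Category.{v₁} B]

/-- The restriction of a diagram to a subset of a poset. -/
abbrev restrictDiagram (D : W ⥤ A) (U : Set W) : U ⥤ A :=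
  Monotone.functor (f := fun x : U => x.1) (fun _ _ h => h) ⋙ D

/-- A compatible family of morphisms, as a cocone on the restriction of a diagram. -/
def restrictCocone (D : W ⥤ A) (U : Set W) (Z : A) (φ : ∀ x ∈ U, D.obj x ⟶ Z)
    (hφ : ∀ x (hx : x ∈ U) y (hy : y ∈ U) (f : x ⟶ y), D.map f ≫ φ y hy = φ x hx) :
    Cocone (restrictDiagram D U) where
  pt := Z
  ι := { app := fun x => φ x.1 x.2
         naturality := fun x y f =>
          (hφ _ x.2 _ y.2 (homOfLE (leOfHom f))).trans (Category.comp_id _).symm }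

variable (lam Φ) in
/-- A diagram of colimits of the restrictions of `D` to small closed subsets. -/
structure SubcolimitDiagram (D : W ⥤ A) where
  diag : SmallClosed lam Φ ⥤ A
  ι (U : SmallClosed lam Φ) (x : W) (hx : x ∈ U.carrier) : D.obj x ⟶ diag.obj U
  w (U : SmallClosed lam Φ) (x : W) (hx : x ∈ U.carrier) (y : W) (hy : y ∈ U.carrier)
    (f : x ⟶ y) : D.map f ≫ ι U y hy = ι U x hx
  ι_map {U V : SmallClosed lam Φ} (i : U ⟶ V) (x : W) (hx : x ∈ U.carrier) :
    ι U x hx ≫ diag.map i = ι V x (SmallClosed.mem_of_hom i hx)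
  isColimit (U : SmallClosed lam Φ) :
    IsColimit (restrictCocone D U.carrier (diag.obj U) (ι U) (w U))

namespace SubcolimitDiagram

variable {D : W ⥤ A} (S : SubcolimitDiagram lam Φ D)

include S in
omit [Fact lam.IsRegular] in
lemma hom_ext {U : SmallClosed lam Φ} {Z : A} {f g : S.diag.obj U ⟶ Z}
    (h : ∀ x (hx : x ∈ U.carrier), S.ι U x hx ≫ f = S.ι U x hx ≫ g) : f = g :=
  (S.isColimit U).hom_ext fun x => h x.1 x.2

omit [Fact lam.IsRegular] in
lemma ι_map_assoc {U V : SmallClosed lam Φ} (i : U ⟶ V) (x : W) (hx : x ∈ U.carrier) {Z : A}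
    (f : S.diag.obj V ⟶ Z) : S.ι U x hx ≫ S.diag.map i ≫ f = S.ι V x (SmallClosed.mem_of_hom i hx) ≫ f := by
  rw [← Category.assoc, S.ι_map]

omit [Fact lam.IsRegular] in
lemma w_assoc (U : SmallClosed lam Φ) (x : W) (hx : x ∈ U.carrier) (y : W) (hy : y ∈ U.carrier)
    (f : x ⟶ y) {Z : A} (g : S.diag.obj U ⟶ Z) :
    D.map f ≫ S.ι U y hy ≫ g = S.ι U x hx ≫ g := by
  rw [← Category.assoc, S.w]

/-- The morphism out of a subcolimit given by a compatible family. -/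
def desc (U : SmallClosed lam Φ) {Z : A} (φ : ∀ x ∈ U.carrier, D.obj x ⟶ Z)
    (hφ : ∀ x (hx : x ∈ U.carrier) y (hy : y ∈ U.carrier) (f : x ⟶ y),
      D.map f ≫ φ y hy = φ x hx) : S.diag.obj U ⟶ Z :=
  (S.isColimit U).desc (restrictCocone D U.carrier Z φ hφ)

omit [Fact lam.IsRegular] in
@[simp]
lemma ι_desc (U : SmallClosed lam Φ) {Z : A} (φ : ∀ x ∈ U.carrier, D.obj x ⟶ Z)
    (hφ : ∀ x (hx : x ∈ U.carrier) y (hy : y ∈ U.carrier) (f : x ⟶ y),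
      D.map f ≫ φ y hy = φ x hx) (x : W) (hx : x ∈ U.carrier) :
    S.ι U x hx ≫ S.desc U φ hφ = φ x hx :=
  (S.isColimit U).fac _ (⟨x, hx⟩ : U.carrier)

omit [Fact lam.IsRegular] in
@[simp]
lemma ι_desc_assoc (U : SmallClosed lam Φ) {Z : A} (φ : ∀ x ∈ U.carrier, D.obj x ⟶ Z)
    (hφ : ∀ x (hx : x ∈ U.carrier) y (hy : y ∈ U.carrier) (f : x ⟶ y),
      D.map f ≫ φ y hy = φ x hx) (x : W) (hx : x ∈ U.carrier) {Z' : A} (g : Z ⟶ Z') :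
    S.ι U x hx ≫ S.desc U φ hφ ≫ g = φ x hx ≫ g := by
  rw [← Category.assoc, ι_desc]

/-- The morphism from a subcolimit to the point of a cocone on the whole diagram. -/
def leg (c : Cocone D) (U : SmallClosed lam Φ) : S.diag.obj U ⟶ c.pt :=
  S.desc U (fun x _ => c.ι.app x) fun _ _ _ _ f => c.w f

omit [Fact lam.IsRegular] in
lemma ι_leg (c : Cocone D) (U : SmallClosed lam Φ) (x : W) (hx : x ∈ U.carrier) :
    S.ι U x hx ≫ S.leg c U = c.ι.app x :=
  S.ι_desc ..

omit [Fact lam.IsRegular] in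
lemma diag_map_leg (c : Cocone D) {U V : SmallClosed lam Φ} (i : U ⟶ V) :
    S.diag.map i ≫ S.leg c V = S.leg c U := S.hom_ext fun x hx => by
  rw [S.ι_map_assoc, S.ι_leg, S.ι_leg]

/-- The cocone on the diagram of subcolimits induced by a cocone on the whole diagram. -/
def cocone (c : Cocone D) : Cocone S.diag where
  pt := c.pt
  ι :=
    { app := S.leg c
      naturality := fun _ _ i => (S.diag_map_leg c i).trans (Category.comp_id _).symm }

/-- The colimit of a diagram is the colimit of its subcolimits. -/
noncomputable def isColimitCocone (hlam : Cardinal.aleph0 < lam)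
    (hΦ : ∀ a b, (Φ a b).Finite) {c : Cocone D} (hc : IsColimit c) :
    IsColimit (S.cocone c) := by
  have hmem := SmallClosed.exists_mem (Φ := Φ) hlam hΦ
  choose V hV using hmem
  -- The morphism out of the term at `x` does not depend on the closed set containing `x`, since any
  -- two closed sets lie in a third.
  have key : ∀ (s : Cocone S.diag) (x : W) (U : SmallClosed lam Φ) (hx : x ∈ U.carrier),
      S.ι (V x) x (hV x) ≫ s.ι.app (V x) = S.ι U x hx ≫ s.ι.app U := by
    intro s x U hx
    have : Nonempty W := ⟨x⟩
    have := SmallClosed.isCardinalFiltered (lam := lam) (Φ := Φ) hlam hΦ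
    have := isFiltered_of_isCardinalFiltered (SmallClosed lam Φ) lam
    rw [← s.w (IsFiltered.leftToMax (V x) U), ← s.w (IsFiltered.rightToMax (V x) U),
      S.ι_map_assoc, S.ι_map_assoc]
  let t (s : Cocone S.diag) : Cocone D :=
    { pt := s.pt
      ι :=
        { app := fun x => S.ι (V x) x (hV x) ≫ s.ι.app (V x)
          naturality := fun x y f => by
            obtain ⟨U, hU⟩ := SmallClosed.exists_superset (Φ := Φ) hlam hΦ {x, y}
              (hasCardinalLT_of_finite _ _ hlam.le) (Set.insert_nonempty _ _)
            have hx : x ∈ U.carrier := hU (by simp)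
            have hy : y ∈ U.carrier := hU (by simp)
            rw [key s x U hx, key s y U hy, S.w_assoc U x hx y hy]
            exact (Category.comp_id _).symm } }
  exact
    { desc := fun s => hc.desc (t s)
      fac := fun s U => S.hom_ext fun x hx =>
        (S.ι_desc_assoc U _ _ x hx _).trans ((hc.fac (t s) x).trans (key s x U hx))
      uniq := fun s m hm => hc.hom_ext fun x =>
        (S.ι_desc_assoc (V x) _ (fun _ _ _ _ f => c.w f) x (hV x) _).symm.trans
          ((congrArg (S.ι (V x) x (hV x) ≫ ·) (hm (V x))).trans (hc.fac (t s) x).symm) }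

variable (lam) in
/-- Subcolimits exist in categories with directed colimits. -/
noncomputable def ofHasDirectedColimits (hA : HasDirectedColimits.{w} A)
    (hub : ∀ a b, ∃ c ∈ Φ a b, a ≤ c ∧ b ≤ c) (D : W ⥤ A) : SubcolimitDiagram lam Φ D := by
  have hD : ∀ U : SmallClosed lam Φ, HasColimit (restrictDiagram D U.carrier) := fun U => by
    have := U.isDirectedOrder hub
    have := hA U.carrier
    infer_instance
  let ι (U : SmallClosed lam Φ) (x : W) (hx : x ∈ U.carrier) :
      D.obj x ⟶ colimit (restrictDiagram D U.carrier) :=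
    colimit.ι (restrictDiagram D U.carrier) ⟨x, hx⟩
  have w (U : SmallClosed lam Φ) (x : W) (hx : x ∈ U.carrier) (y : W) (hy : y ∈ U.carrier)
      (f : x ⟶ y) : D.map f ≫ ι U y hy = ι U x hx :=
    colimit.w (restrictDiagram D U.carrier)
      (homOfLE (show (⟨x, hx⟩ : U.carrier) ≤ ⟨y, hy⟩ from leOfHom f))
  let desc {U V : SmallClosed lam Φ} (i : U ⟶ V) :
      colimit (restrictDiagram D U.carrier) ⟶ colimit (restrictDiagram D V.carrier) :=
    colimit.desc (restrictDiagram D U.carrier) (restrictCocone D U.carrier _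
      (fun x hx => ι V x (SmallClosed.mem_of_hom i hx))
      fun x hx y hy f => w V x (SmallClosed.mem_of_hom i hx) y (SmallClosed.mem_of_hom i hy) f)
  have hdesc {U V : SmallClosed lam Φ} (i : U ⟶ V) (x : W) (hx : x ∈ U.carrier) :
      ι U x hx ≫ desc i = ι V x (SmallClosed.mem_of_hom i hx) :=
    colimit.ι_desc _ _
  have hext {U : SmallClosed lam Φ} {Z : A} {f g : colimit (restrictDiagram D U.carrier) ⟶ Z}
      (h : ∀ x hx, ι U x hx ≫ f = ι U x hx ≫ g) : f = g :=
    colimit.hom_ext fun x => h x.1 x.2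
  let hc (U : SmallClosed lam Φ) : IsColimit (restrictCocone D U.carrier
      (colimit (restrictDiagram D U.carrier)) (ι U) (w U)) :=
    (colimit.isColimit (restrictDiagram D U.carrier)).ofIsoColimit
      (Cocone.ext (Iso.refl _) fun x => Category.comp_id _)
  exact
    { diag :=
        { obj := fun U => colimit (restrictDiagram D U.carrier)
          map := desc
          map_id := fun U => hext fun x hx => (hdesc (𝟙 U) x hx).trans (Category.comp_id _).symm
          map_comp := fun i j => hext fun x hx => by
            have h := hdesc j x (SmallClosed.mem_of_hom i hx)
            rw [← hdesc i x hx, Category.assoc] at h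
            exact (hdesc (i ≫ j) x hx).trans h.symm }
      ι := ι
      w := w
      ι_map := hdesc
      isColimit := fun U => hc U }

/-- The image of a diagram of subcolimits under a functor preserving directed colimits. -/
noncomputable def map (hub : ∀ a b, ∃ c ∈ Φ a b, a ≤ c ∧ b ≤ c) (G : A ⥤ B)
    (hG : PreservesDirectedColimits.{w} G) : SubcolimitDiagram lam Φ (D ⋙ G) where
  diag := S.diag ⋙ G
  ι U x hx := G.map (S.ι U x hx)
  w U x hx y hy f := by
    rw [← S.w U x hx y hy f, G.map_comp]
    rfl
  ι_map i x hx := by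
    rw [← S.ι_map i x hx, G.map_comp]
    rfl
  isColimit U :=
    have := U.isDirectedOrder hub
    have := hG U.carrier
    (isColimitOfPreserves G (S.isColimit U)).ofIsoColimit
      (Cocone.ext (Iso.refl _) fun x => Category.comp_id _)

-- Each subcolimit is a directed colimit of size below `lam`, so it inherits any property stable
-- under such colimits; this is applied to presentability.
omit [Fact lam.IsRegular] in
lemma prop_obj {R : ObjectProperty A}
    (hR : ∀ (J : Type w) [PartialOrder J] [IsDirectedOrder J] [Nonempty J],
      HasCardinalLT J lam → R.IsClosedUnderColimitsOfShape J)
    (hub : ∀ a b, ∃ c ∈ Φ a b, a ≤ c ∧ b ≤ c) (hD : ∀ x, R (D.obj x)) (U : SmallClosed lam Φ) :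
    R (S.diag.obj U) :=
  have := U.isDirectedOrder hub
  have := hR U.carrier U.hasCardinalLT
  R.prop_of_isColimit (S.isColimit U) fun x => hD x.1

end SubcolimitDiagram

end SubsetColimits

/-! ### Directed colimits, filtered colimits and arrow categories -/

section DirectedFiltered

variable {A : Type u} [Category.{v} A] {B : Type u₁} [Category.{v₁} B]

/-- Every small filtered category receives a final functor from a directed poset. -/
lemma HasDirectedColimits.hasColimitsOfShape (hA : HasDirectedColimits.{w} A) (J : Type w)
    [SmallCategory J] [IsFiltered J] : HasColimitsOfShape J A := by
  obtain ⟨α, _, _, _, F, _⟩ := IsFiltered.exists_directed J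
  have := hA α
  exact Functor.Final.hasColimitsOfShape_of_final F

lemma PreservesDirectedColimits.preservesColimitsOfShape {G : A ⥤ B}
    (hG : PreservesDirectedColimits.{w} G) (J : Type w)
    [SmallCategory J] [IsFiltered J] : PreservesColimitsOfShape J G := by
  obtain ⟨α, _, _, _, F, _⟩ := IsFiltered.exists_directed J
  have := hG α
  exact Functor.Final.preservesColimitsOfShape_of_final F G

lemma PreservesDirectedColimits.comp {C : Type u₂} [Category.{v₂} C] {G : A ⥤ B} {H : B ⥤ C}
    (hG : PreservesDirectedColimits.{w} G) (hH : PreservesDirectedColimits.{w} H) :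
    PreservesDirectedColimits.{w} (G ⋙ H) := fun J _ _ _ => by
  have := hG J
  have := hH J
  infer_instance

lemma HasDirectedColimits.arrow (hA : HasDirectedColimits.{w} A) :
    HasDirectedColimits.{w} (Arrow A) := fun J _ _ _ => by
  have := hA J
  infer_instance

lemma HasDirectedColimits.preserves_leftFunc (hA : HasDirectedColimits.{w} A) :
    PreservesDirectedColimits.{w} (Arrow.leftFunc : Arrow A ⥤ A) := fun J _ _ _ => by
  have := hA J
  infer_instance

lemma HasDirectedColimits.preserves_rightFunc (hA : HasDirectedColimits.{w} A) :
    PreservesDirectedColimits.{w} (Arrow.rightFunc : Arrow A ⥤ A) := fun J _ _ _ => by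
  have := hA J
  infer_instance

/-- A cocone of arrows is a colimit when its sources and targets are. -/
def CategoryTheory.Arrow.isColimitOfLeftRight {J : Type u₂} [Category.{v₂} J] {H : J ⥤ Arrow A} {c : Cocone H}
    (hl : IsColimit (Arrow.leftFunc.mapCocone c)) (hr : IsColimit (Arrow.rightFunc.mapCocone c)) :
    IsColimit c where
  desc s := Arrow.homMk (hl.desc (Arrow.leftFunc.mapCocone s))
    (hr.desc (Arrow.rightFunc.mapCocone s)) (hl.hom_ext fun j => by
      let l : c.pt.left ⟶ s.pt.left := hl.desc (Arrow.leftFunc.mapCocone s)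
      let r : c.pt.right ⟶ s.pt.right := hr.desc (Arrow.rightFunc.mapCocone s)
      have h1 : (c.ι.app j).left ≫ l = (s.ι.app j).left :=
        hl.fac (Arrow.leftFunc.mapCocone s) j
      have h2 : (c.ι.app j).right ≫ r = (s.ι.app j).right :=
        hr.fac (Arrow.rightFunc.mapCocone s) j
      let q : H.obj j ⟶ c.pt := c.ι.app j
      let q' : H.obj j ⟶ s.pt := s.ι.app j
      change q.left ≫ l ≫ s.pt.hom = q.left ≫ c.pt.hom ≫ r
      calc q.left ≫ l ≫ s.pt.hom = q'.left ≫ s.pt.hom := by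
            rw [← Category.assoc]; exact congrArg (· ≫ s.pt.hom) h1
        _ = (H.obj j).hom ≫ q'.right := Arrow.w q'
        _ = (H.obj j).hom ≫ q.right ≫ r := congrArg ((H.obj j).hom ≫ ·) h2.symm
        _ = q.left ≫ c.pt.hom ≫ r := by rw [← Category.assoc, ← Arrow.w q, Category.assoc])
  fac s j := Arrow.hom_ext _ _ (hl.fac (Arrow.leftFunc.mapCocone s) j)
    (hr.fac (Arrow.rightFunc.mapCocone s) j)
  uniq s m hm := Arrow.hom_ext _ _
    (hl.uniq (Arrow.leftFunc.mapCocone s) _ fun j => congrArg CommaMorphism.left (hm j))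
    (hr.uniq (Arrow.rightFunc.mapCocone s) _ fun j => congrArg CommaMorphism.right (hm j))

lemma PreservesDirectedColimits.mapArrow {G : A ⥤ B} (hA : HasDirectedColimits.{w} A)
    (hG : PreservesDirectedColimits.{w} G) :
    PreservesDirectedColimits.{w} G.mapArrow := fun J _ _ _ => by
  have := hA J
  have := hG J
  refine ⟨fun {H} => ⟨fun {c} hc => ⟨Arrow.isColimitOfLeftRight ?_ ?_⟩⟩⟩
  · exact isColimitOfPreserves G (isColimitOfPreserves Arrow.leftFunc hc)
  · exact isColimitOfPreserves G (isColimitOfPreserves Arrow.rightFunc hc)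

end DirectedFiltered

/-! ### Presentable objects and raising the index of accessibility -/

section Presentability

variable {A : Type u} [Category.{v} A] {B : Type u₁} [Category.{v₁} B]
  {lam : Cardinal.{w}} [Fact lam.IsRegular]

/-- An elementary criterion for presentability. -/
lemma isCardinalPresentable_of_factorization (X : A)
    (h₁ : ∀ (J : Type w) [SmallCategory J] [IsCardinalFiltered J lam] (H : J ⥤ A) (c : Cocone H),
      IsColimit c → ∀ f : X ⟶ c.pt, ∃ (j : J) (g : X ⟶ H.obj j), g ≫ c.ι.app j = f)
    (h₂ : ∀ (J : Type w) [SmallCategory J] [IsCardinalFiltered J lam] (H : J ⥤ A) (c : Cocone H),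
      IsColimit c → ∀ (j : J) (f g : X ⟶ H.obj j), f ≫ c.ι.app j = g ≫ c.ι.app j →
        ∃ (k : J) (a : j ⟶ k), f ≫ H.map a = g ≫ H.map a) :
    IsCardinalPresentable X lam where
  preservesColimitOfShape J _ _ := ⟨fun {H} => ⟨fun {c} hc => ⟨by
    have := isFiltered_of_isCardinalFiltered J lam
    apply Types.FilteredColimit.isColimitOf'
    · intro f
      obtain ⟨j, g, hg⟩ := h₁ J H c hc f
      exact ⟨j, g, hg.symm⟩
    · intro j f g h
      exact h₂ J H c hc j f g h⟩⟩⟩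

/-- An arrow between presentable objects is presentable. -/
lemma CategoryTheory.Arrow.isCardinalPresentable (hA : HasDirectedColimits.{w} A) (f : Arrow A)
    (hl : IsCardinalPresentable f.left lam) (hr : IsCardinalPresentable f.right lam) :
    IsCardinalPresentable f lam := by
  apply isCardinalPresentable_of_factorization
  · intro J _ _ H c hc g
    have := isFiltered_of_isCardinalFiltered J lam
    have := hA.preserves_leftFunc.preservesColimitsOfShape J
    have := hA.preserves_rightFunc.preservesColimitsOfShape J
    have hcl := isColimitOfPreserves Arrow.leftFunc hc
    have hcr := isColimitOfPreserves Arrow.rightFunc hc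
    obtain ⟨j₁, (l : f.left ⟶ (H.obj j₁).left), (hl' : l ≫ (c.ι.app j₁).left = g.left)⟩ :=
      IsCardinalPresentable.exists_hom_of_isColimit lam hcl g.left
    obtain ⟨j₂, (r : f.right ⟶ (H.obj j₂).right), (hr' : r ≫ (c.ι.app j₂).right = g.right)⟩ :=
      IsCardinalPresentable.exists_hom_of_isColimit lam hcr g.right
    -- The two components factor separately, so they need not form a square yet. They do at a later
    -- stage, because the source of the arrow is presentable.
    obtain ⟨k, a, b, (hk : (l ≫ (H.obj j₁).hom) ≫ (H.map a).right =
        (f.hom ≫ r) ≫ (H.map b).right)⟩ := IsCardinalPresentable.exists_eq_of_isColimit lam hcr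
      (l ≫ (H.obj j₁).hom) (f.hom ≫ r) (by
        change (l ≫ (H.obj j₁).hom) ≫ (c.ι.app j₁).right = (f.hom ≫ r) ≫ (c.ι.app j₂).right
        rw [Category.assoc, ← Arrow.w (c.ι.app j₁), ← Category.assoc, hl', Category.assoc, hr']
        exact Arrow.w g)
    refine ⟨k, Arrow.homMk (l ≫ (H.map a).left) (r ≫ (H.map b).right) ?_, ?_⟩
    · rw [Category.assoc, Arrow.w, ← Category.assoc, hk, Category.assoc]
    · ext
      · have := congrArg Arrow.Hom.left (c.w a)
        refine (Category.assoc _ _ _).trans ((congrArg (l ≫ ·) this).trans hl')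
      · have := congrArg Arrow.Hom.right (c.w b)
        refine (Category.assoc _ _ _).trans ((congrArg (r ≫ ·) this).trans hr')
  · intro J _ _ H c hc j g g' h
    have := isFiltered_of_isCardinalFiltered J lam
    have := hA.preserves_leftFunc.preservesColimitsOfShape J
    have := hA.preserves_rightFunc.preservesColimitsOfShape J
    have hcl := isColimitOfPreserves Arrow.leftFunc hc
    have hcr := isColimitOfPreserves Arrow.rightFunc hc
    obtain ⟨k₁, a₁, (h₁ : g.left ≫ (H.map a₁).left = g'.left ≫ (H.map a₁).left)⟩ :=
      IsCardinalPresentable.exists_eq_of_isColimit' lam hcl g.left g'.left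
      (congrArg Arrow.Hom.left h)
    obtain ⟨k₂, a₂, (h₂ : g.right ≫ (H.map a₂).right = g'.right ≫ (H.map a₂).right)⟩ :=
      IsCardinalPresentable.exists_eq_of_isColimit' lam hcr g.right g'.right
      (congrArg Arrow.Hom.right h)
    obtain ⟨k, b₁, b₂, hb⟩ := IsFiltered.span a₁ a₂
    refine ⟨k, a₁ ≫ b₁, ?_⟩
    ext
    · dsimp
      rw [H.map_comp, Arrow.comp_left, ← Category.assoc, h₁, Category.assoc]
    · dsimp
      rw [hb, H.map_comp, Arrow.comp_right, ← Category.assoc, h₂, Category.assoc]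

variable (lam) in
/-- Closure of a class of objects under directed colimits of size `< lam`. -/
def IsClosedUnderSmallDirectedColimits (R : ObjectProperty A) : Prop :=
  ∀ (J : Type w) [PartialOrder J] [IsDirectedOrder J] [Nonempty J],
    HasCardinalLT J lam → R.IsClosedUnderColimitsOfShape J

variable (A lam) in
lemma isClosedUnderSmallDirectedColimits_isCardinalPresentable [LocallySmall.{w} A] :
    IsClosedUnderSmallDirectedColimits lam (isCardinalPresentable A lam) :=
  fun J _ _ _ hJ => isClosedUnderColimitsOfShape_isCardinalPresentable A
    (hasCardinalLT_arrow_of_preorder J hJ)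

omit [Fact lam.IsRegular] in
lemma IsClosedUnderSmallDirectedColimits.inf {R R' : ObjectProperty A}
    (h : IsClosedUnderSmallDirectedColimits lam R)
    (h' : IsClosedUnderSmallDirectedColimits lam R') :
    IsClosedUnderSmallDirectedColimits lam (R ⊓ R') := fun J _ _ _ hJ => by
  have := h J hJ
  have := h' J hJ
  exact ⟨fun X ⟨p⟩ => ⟨(p.ofLE inf_le_left).prop, (p.ofLE inf_le_right).prop⟩⟩

omit [Fact lam.IsRegular] in
lemma IsClosedUnderSmallDirectedColimits.inverseImage {R : ObjectProperty B}
    (h : IsClosedUnderSmallDirectedColimits lam R) {G : A ⥤ B}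
    (hG : PreservesDirectedColimits.{w} G) :
    IsClosedUnderSmallDirectedColimits lam (R.inverseImage G) := fun J _ _ _ hJ => by
  have := h J hJ
  have := hG J
  infer_instance

lemma exists_upperBound_op (W : Type w) [PartialOrder W] [IsDirectedOrder W] :
    ∃ ub : W → W → W, ∀ a b, a ≤ ub a b ∧ b ≤ ub a b := by
  choose ub h using fun a b : W => exists_ge_ge a b
  exact ⟨ub, h⟩

lemma CategoryTheory.ObjectProperty.IsCardinalFilteredGenerator.exists_poset {R : ObjectProperty A}
    (hR : R.IsCardinalFilteredGenerator lam) (X : A) :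
    ∃ (W : Type w) (_ : PartialOrder W) (_ : IsCardinalFiltered W lam),
      Nonempty (R.ColimitOfShape W X) := by
  obtain ⟨J, _, _, ⟨p⟩⟩ := hR.exists_colimitsOfShape X
  obtain ⟨W, _, _, F, _⟩ := IsCardinalFiltered.exists_cardinal_directed J lam
  exact ⟨W, _, inferInstance, ⟨p.reindex F⟩⟩

/-- The projections from a product of filtered categories are final, so both colimits can be
reindexed over the product, and then over a directed poset. -/
lemma CategoryTheory.ObjectProperty.IsCardinalFilteredGenerator.exists_common_poset {R : ObjectProperty A}
    {R' : ObjectProperty B} (hR : R.IsCardinalFilteredGenerator lam)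
    (hR' : R'.IsCardinalFilteredGenerator lam) (X : A) (Y : B) :
    ∃ (W : Type w) (_ : PartialOrder W) (_ : IsCardinalFiltered W lam),
      Nonempty (R.ColimitOfShape W X) ∧ Nonempty (R'.ColimitOfShape W Y) := by
  obtain ⟨J, _, _, ⟨p⟩⟩ := hR.exists_colimitsOfShape X
  obtain ⟨J', _, _, ⟨p'⟩⟩ := hR'.exists_colimitsOfShape Y
  have := isFiltered_of_isCardinalFiltered J lam
  have := isFiltered_of_isCardinalFiltered J' lam
  obtain ⟨W, _, _, F, _⟩ := IsCardinalFiltered.exists_cardinal_directed (J × J') lam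
  exact ⟨W, _, inferInstance, ⟨(p.reindex (CategoryTheory.Prod.fst J J')).reindex F⟩,
    ⟨(p'.reindex (CategoryTheory.Prod.snd J J')).reindex F⟩⟩

/-- In a category with directed colimits, a generating class of presentable objects may be
replaced by one of any higher index of accessibility. -/
lemma CategoryTheory.ObjectProperty.IsCardinalFilteredGenerator.of_le (hA : HasDirectedColimits.{w} A)
    {κ : Cardinal.{w}} [Fact κ.IsRegular] (hlam : Cardinal.aleph0 < lam)
    {P R : ObjectProperty A} (hP : P.IsCardinalFilteredGenerator κ) (hPR : P ≤ R)
    (hR : IsClosedUnderSmallDirectedColimits lam R) (hR' : R ≤ isCardinalPresentable A lam) :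
    R.IsCardinalFilteredGenerator lam where
  le_isCardinalPresentable := hR'
  exists_colimitsOfShape X := by
    obtain ⟨W, _, _, ⟨p⟩⟩ := hP.exists_poset X
    have := isFiltered_of_isCardinalFiltered W κ
    have := IsFiltered.isDirectedOrder W
    have := IsFiltered.nonempty (C := W)
    obtain ⟨ub, hub⟩ := exists_upperBound_op W
    -- Closure under one chosen upper bound already makes a subset directed. No relation between `κ`
    -- and `lam` enters here: the subcolimits exist because all directed colimits do.
    let Φ : W → W → Set W := fun a b => {ub a b}
    have hΦ : ∀ a b, (Φ a b).Finite := fun a b => Set.finite_singleton _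
    have hub' : ∀ a b, ∃ c ∈ Φ a b, a ≤ c ∧ b ≤ c := fun a b => ⟨_, rfl, hub a b⟩
    let S := SubcolimitDiagram.ofHasDirectedColimits lam hA hub' p.diag
    exact ⟨SmallClosed lam Φ, inferInstance, SmallClosed.isCardinalFiltered hlam hΦ,
      ⟨{ diag := S.diag
         ι := (S.cocone p.cocone).ι
         isColimit := S.isColimitCocone hlam hΦ p.isColimit
         prop_diag_obj := S.prop_obj hR hub' fun x => hPR _ (p.prop_diag_obj x) }⟩⟩

end Presentability

/-! ### Representing a morphism of colimits by maps between terms -/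

section IndexedMaps

variable {W : Type w} [PartialOrder W] {B : Type u} [Category.{v} B]
  {lam : Cardinal.{w}} [Fact lam.IsRegular]

/-- A representation of a morphism between the points of two cocones on diagrams indexed by the
same poset by morphisms between the terms of the diagrams. -/
structure IndexedMap {x y : W ⥤ B} (cx : Cocone x) (cy : Cocone y) (f : cx.pt ⟶ cy.pt) where
  idx : W → W
  hom (a : W) : x.obj a ⟶ y.obj (idx a)
  fac (a : W) : hom a ≫ cy.ι.app (idx a) = cx.ι.app a ≫ f
  bound : W → W → W
  compat {a b : W} (i : a ⟶ b) : ∃ (e : idx a ⟶ bound a b) (e' : idx b ⟶ bound a b),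
    hom a ≫ y.map e = x.map i ≫ hom b ≫ y.map e'

namespace IndexedMap

variable {x y : W ⥤ B} {cx : Cocone x} {cy : Cocone y}

lemma nonempty [IsCardinalFiltered W lam] (hx : ∀ a, IsCardinalPresentable (x.obj a) lam)
    (hy : IsColimit cy) (f : cx.pt ⟶ cy.pt) : Nonempty (IndexedMap cx cy f) := by
  have h₁ (a : W) := IsCardinalPresentable.exists_hom_of_isColimit lam hy (cx.ι.app a ≫ f)
  choose idx hom fac using h₁
  have h₂ (a b : W) : ∃ c : W, ∀ i : a ⟶ b, ∃ (e : idx a ⟶ c) (e' : idx b ⟶ c),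
      hom a ≫ y.map e = x.map i ≫ hom b ≫ y.map e' := by
    by_cases hab : a ≤ b
    · let i : a ⟶ b := homOfLE hab
      obtain ⟨c, e, e', h⟩ := IsCardinalPresentable.exists_eq_of_isColimit lam hy (hom a)
        (x.map i ≫ hom b) (by
          rw [fac, Category.assoc, fac]
          exact (congrArg (· ≫ f) (cx.w i)).symm.trans (Category.assoc _ _ _))
      refine ⟨c, fun j => ?_⟩
      obtain rfl : i = j := Subsingleton.elim _ _
      exact ⟨e, e', by rw [h, Category.assoc]⟩
    · exact ⟨a, fun i => (hab (leOfHom i)).elim⟩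
  choose bound compat using h₂
  exact ⟨⟨idx, hom, fac, bound, fun {a b} i => compat a b i⟩⟩

variable {Φ : W → W → Set W} {f : cx.pt ⟶ cy.pt} (M : IndexedMap cx cy f)
  (Sx : SubcolimitDiagram lam Φ x) (Sy : SubcolimitDiagram lam Φ y)
  (h₁ : ∀ a, M.idx a ∈ Φ a a) (h₂ : ∀ a b, M.bound a b ∈ Φ a b)

include h₁ in
omit [Fact lam.IsRegular] in
lemma idx_mem (U : SmallClosed lam Φ) {a : W} (ha : a ∈ U.carrier) : M.idx a ∈ U.carrier :=
  U.closed a ha a ha (h₁ a)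

/-- The morphism of diagrams of subcolimits induced by a morphism of indexed diagrams. -/
def natTrans : Sx.diag ⟶ Sy.diag where
  app U := Sx.desc U (fun a ha => M.hom a ≫ Sy.ι U (M.idx a) (M.idx_mem h₁ U ha))
    fun a ha b hb i => by
      obtain ⟨e, e', h⟩ := M.compat i
      -- The two ways of mapping the term at `a` agree at the index `M.bound a b`; closure under it
      -- keeps that agreement inside `U`.
      have hc : M.bound a b ∈ U.carrier := U.closed a ha b hb (h₂ a b)
      rw [← Sy.w U _ (M.idx_mem h₁ U ha) _ hc e, ← Sy.w U _ (M.idx_mem h₁ U hb) _ hc e',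
        ← Category.assoc (M.hom a), h]
      simp only [Category.assoc]
  naturality U V i := Sx.hom_ext fun a ha => by
    rw [Sx.ι_map_assoc, Sx.ι_desc, Sx.ι_desc_assoc, Category.assoc, Sy.ι_map]

omit [Fact lam.IsRegular] in
lemma ι_natTrans (U : SmallClosed lam Φ) (a : W) (ha : a ∈ U.carrier) :
    Sx.ι U a ha ≫ (M.natTrans Sx Sy h₁ h₂).app U =
      M.hom a ≫ Sy.ι U (M.idx a) (M.idx_mem h₁ U ha) :=
  Sx.ι_desc ..

omit [Fact lam.IsRegular] in
lemma natTrans_leg (U : SmallClosed lam Φ) :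
    (M.natTrans Sx Sy h₁ h₂).app U ≫ Sy.leg cy U = Sx.leg cx U ≫ f := Sx.hom_ext fun a ha => by
  rw [← Category.assoc, M.ι_natTrans, Category.assoc, Sy.ι_leg, ← Category.assoc, Sx.ι_leg]
  exact M.fac a

/-- Mutually inverse morphisms are eventually inverse on the terms of the diagrams. -/
lemma exists_eq_id [IsCardinalFiltered W lam] (hx : ∀ a, IsCardinalPresentable (x.obj a) lam)
    (hcx : IsColimit cx) {g : cy.pt ⟶ cx.pt} (N : IndexedMap cy cx g) (hfg : f ≫ g = 𝟙 _) (a : W) :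
    ∃ (c : W) (e : a ⟶ c) (e' : N.idx (M.idx a) ⟶ c),
      x.map e = M.hom a ≫ N.hom (M.idx a) ≫ x.map e' := by
  obtain ⟨c, e, e', h⟩ := IsCardinalPresentable.exists_eq_of_isColimit lam hcx (𝟙 (x.obj a))
    (M.hom a ≫ N.hom (M.idx a)) (by
      rw [Category.assoc, N.fac, ← Category.assoc, M.fac, Category.assoc, hfg, Category.id_comp]
      exact (Category.comp_id _).symm)
  exact ⟨c, e, e', by rw [Category.id_comp] at h; rw [h, Category.assoc]⟩

-- The composite is the identity only after passing to a later index `c`. If `Φ` records such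
-- indices, they lie in every closed set containing `a`, and the composite is the identity on every
-- subcolimit.
omit [Fact lam.IsRegular] in
lemma natTrans_comp {g : cy.pt ⟶ cx.pt} (N : IndexedMap cy cx g)
    (h₁' : ∀ a, N.idx a ∈ Φ a a) (h₂' : ∀ a b, N.bound a b ∈ Φ a b)
    (h : ∀ a, ∃ c ∈ Φ a a, ∃ (e : a ⟶ c) (e' : N.idx (M.idx a) ⟶ c),
      x.map e = M.hom a ≫ N.hom (M.idx a) ≫ x.map e') :
    M.natTrans Sx Sy h₁ h₂ ≫ N.natTrans Sy Sx h₁' h₂' = 𝟙 _ := by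
  ext U
  refine Sx.hom_ext fun a ha => ?_
  obtain ⟨c, hc, e, e', hcomp⟩ := h a
  have hc' : c ∈ U.carrier := U.closed a ha a ha hc
  have hm := M.idx_mem h₁ U ha
  have hn := N.idx_mem h₁' U hm
  rw [NatTrans.comp_app, ← Category.assoc, M.ι_natTrans, Category.assoc, N.ι_natTrans,
    ← Sx.w U _ hn c hc' e', NatTrans.id_app, Category.comp_id, ← Sx.w U a ha c hc' e, hcomp]
  simp only [Category.assoc]

end IndexedMap

/-- In a category with directed colimits, an arrow is a directed colimit of arrows between
presentable objects. -/
theorem CategoryTheory.Arrow.isCardinalFilteredGenerator {A : Type u} [Category.{v} A]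
    (hA : HasDirectedColimits.{w} A) (hlam : Cardinal.aleph0 < lam) {R : ObjectProperty A}
    (hR : R.IsCardinalFilteredGenerator lam) (hR' : IsClosedUnderSmallDirectedColimits lam R) :
    (R.inverseImage Arrow.leftFunc ⊓
      R.inverseImage Arrow.rightFunc).IsCardinalFilteredGenerator lam where
  le_isCardinalPresentable f hf := Arrow.isCardinalPresentable hA f
    (hR.le_isCardinalPresentable _ hf.1) (hR.le_isCardinalPresentable _ hf.2)
  exists_colimitsOfShape f := by
    obtain ⟨W, _, _, ⟨p⟩, ⟨q⟩⟩ := hR.exists_common_poset hR f.left f.right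
    have := isFiltered_of_isCardinalFiltered W lam
    have := IsFiltered.isDirectedOrder W
    have := IsFiltered.nonempty (C := W)
    obtain ⟨ub, hub⟩ := exists_upperBound_op W
    obtain ⟨M⟩ := IndexedMap.nonempty (lam := lam) (cx := p.cocone) (cy := q.cocone)
      (fun a => hR.le_isCardinalPresentable _ (p.prop_diag_obj a)) q.isColimit f.hom
    -- Closure under `ub` makes the subsets directed; closure under `M.idx` and `M.bound` makes
    -- `f.hom` restrict to the subcolimits.
    let Φ : W → W → Set W := fun a b => {ub a b, M.idx a, M.bound a b}
    have hΦ : ∀ a b, (Φ a b).Finite := fun a b => Set.toFinite _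
    have hub' : ∀ a b, ∃ c ∈ Φ a b, a ≤ c ∧ b ≤ c := fun a b => ⟨ub a b, by simp [Φ], hub a b⟩
    let S := SubcolimitDiagram.ofHasDirectedColimits lam hA hub' p.diag
    let T := SubcolimitDiagram.ofHasDirectedColimits lam hA hub' q.diag
    have h₁ : ∀ a, M.idx a ∈ Φ a a := by simp [Φ]
    have h₂ : ∀ a b, M.bound a b ∈ Φ a b := by simp [Φ]
    let α := M.natTrans S T h₁ h₂
    let H : SmallClosed lam Φ ⥤ Arrow A :=
      { obj := fun U => Arrow.mk (α.app U)
        map := fun i => Arrow.homMk (S.diag.map i) (T.diag.map i) (α.naturality i)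
        map_id := fun U => Arrow.hom_ext _ _ (S.diag.map_id U) (T.diag.map_id U)
        map_comp := fun i j => Arrow.hom_ext _ _ (S.diag.map_comp i j) (T.diag.map_comp i j) }
    let c : Cocone H :=
      { pt := f
        ι :=
          { app := fun U => Arrow.homMk (S.leg p.cocone U) (T.leg q.cocone U)
              (M.natTrans_leg S T h₁ h₂ U).symm
            naturality := fun U V i => by
              refine Eq.trans ?_ (Category.comp_id _).symm
              exact Arrow.hom_ext _ _ (S.diag_map_leg p.cocone i) (T.diag_map_leg q.cocone i) } }
    have hc : IsColimit c := Arrow.isColimitOfLeftRight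
      (S.isColimitCocone hlam hΦ p.isColimit) (T.isColimitCocone hlam hΦ q.isColimit)
    exact ⟨SmallClosed lam Φ, inferInstance, SmallClosed.isCardinalFiltered hlam hΦ,
      ⟨{ diag := H
         ι := c.ι
         isColimit := hc
         prop_diag_obj := fun U => ⟨S.prop_obj hR' hub' p.prop_diag_obj U,
          T.prop_obj hR' hub' q.prop_diag_obj U⟩ }⟩⟩

end IndexedMaps

/-! ### Pseudo-pullbacks: colimits, presentability and generators -/

section Pullback

variable {P : Type u} [Category.{v} P] {A : Type u₁} [Category.{v₁} A]
  {S : Type u₂} [Category.{v₂} S] {B : Type u₃} [Category.{v₃} B]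

/-- The square of functors formed by `π`, `τ`, `G`, `K`, where `K` is faithful, exhibits its
source as a pseudo-pullback. -/
structure IsPseudoPullback (π : P ⥤ A) (τ : P ⥤ S) (G : A ⥤ B) (K : S ⥤ B)
    (e : π ⋙ G ≅ τ ⋙ K) : Prop where
  faithful_fst : π.Faithful
  faithful_right : K.Faithful
  lift_hom {p q : P} (f : π.obj p ⟶ π.obj q) (g : τ.obj p ⟶ τ.obj q) :
    G.map f ≫ e.hom.app q = e.hom.app p ≫ K.map g → ∃ h : p ⟶ q, π.map h = f
  lift_obj (a : A) (s : S) (θ : G.obj a ≅ K.obj s) :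
    ∃ (p : P) (i : π.obj p ≅ a) (j : τ.obj p ≅ s),
      G.map i.hom ≫ θ.hom = e.hom.app p ≫ K.map j.hom

namespace IsPseudoPullback

variable {π : P ⥤ A} {τ : P ⥤ S} {G : A ⥤ B} {K : S ⥤ B} {e : π ⋙ G ≅ τ ⋙ K}
  (h : IsPseudoPullback π τ G K e)

include h

/-- The second component comes for free: `e` is invertible and `K` is faithful, so naturality of `e`
forces `τ.map l = g`. -/
lemma exists_lift {p q : P} (f : π.obj p ⟶ π.obj q) (g : τ.obj p ⟶ τ.obj q)
    (hfg : G.map f ≫ e.hom.app q = e.hom.app p ≫ K.map g) :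
    ∃ l : p ⟶ q, π.map l = f ∧ τ.map l = g := by
  obtain ⟨l, rfl⟩ := h.lift_hom f g hfg
  refine ⟨l, rfl, ?_⟩
  have := h.faithful_right
  apply K.map_injective
  rw [← cancel_epi (e.hom.app p)]
  exact (e.hom.naturality l).symm.trans hfg

/-- Compatible functors to the corners lift to the pseudo-pullback. -/
lemma exists_functor {J : Type u₄} [Category.{v₄} J] (a : J ⥤ A) (s : J ⥤ S)
    (θ : a ⋙ G ≅ s ⋙ K) :
    ∃ (H : J ⥤ P) (i : H ⋙ π ≅ a) (j : H ⋙ τ ≅ s),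
      ∀ x, G.map (i.hom.app x) ≫ θ.hom.app x = e.hom.app (H.obj x) ≫ K.map (j.hom.app x) := by
  have hobj (x : J) := h.lift_obj (a.obj x) (s.obj x) (θ.app x)
  choose p i j hp using hobj
  have hp' (x : J) : G.map (i x).inv ≫ e.hom.app (p x) = θ.hom.app x ≫ K.map (j x).inv := by
    have := hp x
    rw [← cancel_epi (G.map (i x).hom), ← Category.assoc, ← G.map_comp, Iso.hom_inv_id, G.map_id,
      Category.id_comp, ← Category.assoc]
    refine Eq.trans ?_ (congrArg (· ≫ K.map (j x).inv) this.symm)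
    rw [Category.assoc, ← K.map_comp, Iso.hom_inv_id, K.map_id]
    exact (Category.comp_id _).symm
  have hmap {x y : J} (f : x ⟶ y) : ∃ l : p x ⟶ p y,
      π.map l = (i x).hom ≫ a.map f ≫ (i y).inv ∧ τ.map l = (j x).hom ≫ s.map f ≫ (j y).inv := by
    apply h.exists_lift
    have hn : G.map (a.map f) ≫ θ.hom.app y = θ.hom.app x ≫ K.map (s.map f) :=
      θ.hom.naturality f
    have hx : G.map (i x).hom ≫ θ.hom.app x = e.hom.app (p x) ≫ K.map (j x).hom := hp x
    calc G.map ((i x).hom ≫ a.map f ≫ (i y).inv) ≫ e.hom.app (p y)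
        = G.map (i x).hom ≫ G.map (a.map f) ≫ G.map (i y).inv ≫ e.hom.app (p y) := by
          rw [G.map_comp, G.map_comp]
          exact (Category.assoc _ _ _).trans (congrArg (G.map (i x).hom ≫ ·) (Category.assoc _ _ _))
      _ = G.map (i x).hom ≫ (G.map (a.map f) ≫ θ.hom.app y) ≫ K.map (j y).inv := by
          rw [hp' y]
          exact congrArg (G.map (i x).hom ≫ ·) (Category.assoc _ _ _).symm
      _ = (G.map (i x).hom ≫ θ.hom.app x) ≫ K.map (s.map f) ≫ K.map (j y).inv := by
          rw [hn]
          exact (congrArg (G.map (i x).hom ≫ ·) (Category.assoc _ _ _)).trans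
            (Category.assoc _ _ _).symm
      _ = _ := by
          rw [hx, K.map_comp, K.map_comp]
          exact Category.assoc _ _ _
  choose m hm hm' using @hmap
  have := h.faithful_fst
  let H : J ⥤ P :=
    { obj := p
      map := m
      map_id := fun x => π.map_injective (by simp [hm])
      map_comp := fun f g => π.map_injective (by simp [hm]) }
  refine ⟨H, NatIso.ofComponents i fun {x y} f => ?_, NatIso.ofComponents j fun {x y} f => ?_, hp⟩
  · change π.map (m f) ≫ _ = _
    rw [hm]
    simp
  · change τ.map (m f) ≫ _ = _
    rw [hm']
    simp

/-- The projections from a pseudo-pullback jointly reflect colimits. -/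
lemma nonempty_isColimit {J : Type u₄} [Category.{v₄} J] {H : J ⥤ P} {c : Cocone H}
    [PreservesColimit (H ⋙ π) G] (hπ : IsColimit (π.mapCocone c))
    (hτ : IsColimit (τ.mapCocone c)) : Nonempty (IsColimit c) := by
  have := h.faithful_fst
  have hG := isColimitOfPreserves G hπ
  have key (s : Cocone H) : ∃ l : c.pt ⟶ s.pt,
      π.map l = hπ.desc (π.mapCocone s) ∧ τ.map l = hτ.desc (τ.mapCocone s) := by
    apply h.exists_lift
    -- Since `G` preserves the colimit, compatibility of the two induced morphisms over `B` may be
    -- tested on coprojections.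
    refine hG.hom_ext fun j => ?_
    have h₁ : π.map (c.ι.app j) ≫ hπ.desc (π.mapCocone s) = π.map (s.ι.app j) := hπ.fac _ j
    have h₂ : τ.map (c.ι.app j) ≫ hτ.desc (τ.mapCocone s) = τ.map (s.ι.app j) := hτ.fac _ j
    let qc : H.obj j ⟶ c.pt := c.ι.app j
    let qs : H.obj j ⟶ s.pt := s.ι.app j
    have n₁ : G.map (π.map qc) ≫ e.hom.app c.pt = e.hom.app (H.obj j) ≫ K.map (τ.map qc) :=
      e.hom.naturality qc
    have n₂ : G.map (π.map qs) ≫ e.hom.app s.pt = e.hom.app (H.obj j) ≫ K.map (τ.map qs) :=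
      e.hom.naturality qs
    change G.map (π.map qc) ≫ G.map (hπ.desc (π.mapCocone s)) ≫ e.hom.app s.pt =
      G.map (π.map qc) ≫ e.hom.app c.pt ≫ K.map (hτ.desc (τ.mapCocone s))
    calc _ = G.map (π.map qc ≫ hπ.desc (π.mapCocone s)) ≫ e.hom.app s.pt := by
          rw [G.map_comp]; exact (Category.assoc _ _ _).symm
      _ = G.map (π.map qs) ≫ e.hom.app s.pt := congrArg (fun t => G.map t ≫ e.hom.app s.pt) h₁
      _ = e.hom.app (H.obj j) ≫ K.map (τ.map qs) := n₂
      _ = e.hom.app (H.obj j) ≫ K.map (τ.map qc ≫ hτ.desc (τ.mapCocone s)) :=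
          congrArg (fun t => e.hom.app (H.obj j) ≫ K.map t) h₂.symm
      _ = (e.hom.app (H.obj j) ≫ K.map (τ.map qc)) ≫ K.map (hτ.desc (τ.mapCocone s)) := by
          rw [K.map_comp]; exact (Category.assoc _ _ _).symm
      _ = _ := by rw [← n₁]; exact Category.assoc _ _ _
  choose l hl hl' using key
  exact ⟨{
    desc := l
    fac := fun s j => π.map_injective (by
      rw [π.map_comp, hl]
      exact hπ.fac _ j)
    uniq := fun s m hm => π.map_injective (by
      rw [hl]
      exact hπ.uniq (π.mapCocone s) _ fun j =>
        (π.map_comp _ _).symm.trans (congrArg π.map (hm j))) }⟩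

/-- Compatible colimit cocones in the corners lift to the pseudo-pullback. -/
lemma exists_cocone {J : Type u₄} [Category.{v₄} J] {H : J ⥤ P} {p : P}
    (ca : ∀ x, π.obj (H.obj x) ⟶ π.obj p) (cs : ∀ x, τ.obj (H.obj x) ⟶ τ.obj p)
    (hca : ∀ {x y} (f : x ⟶ y), π.map (H.map f) ≫ ca y = ca x)
    (hc : ∀ x, G.map (ca x) ≫ e.hom.app p = e.hom.app (H.obj x) ≫ K.map (cs x)) :
    ∃ ι : H ⟶ (Functor.const J).obj p, (∀ x, π.map (ι.app x) = ca x) ∧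
      ∀ x, τ.map (ι.app x) = cs x := by
  have := h.faithful_fst
  have key (x : J) := h.exists_lift (ca x) (cs x) (hc x)
  choose l hl hl' using key
  exact ⟨{
    app := l
    naturality := fun x y f => π.map_injective (by
      refine (π.map_comp _ _).trans ?_
      rw [hl, hca, ← hl]
      exact congrArg π.map (Category.comp_id _).symm) }, hl, hl'⟩

omit h in
lemma isColimit_mapCocone_of_eq {C : Type u₂} [Category.{v₂} C] {J : Type u₄} [Category.{v₄} J]
    {H : J ⥤ P} {F : P ⥤ C} {a : J ⥤ C} (i : H ⋙ F ≅ a) {c : Cocone H} {ca : Cocone a}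
    (hca : IsColimit ca) (j : F.obj c.pt ≅ ca.pt)
    (hc : ∀ x, F.map (c.ι.app x) ≫ j.hom = i.hom.app x ≫ ca.ι.app x) :
    Nonempty (IsColimit (F.mapCocone c)) :=
  ⟨((IsColimit.precomposeHomEquiv i ca).symm hca).ofIsoColimit
    (Cocone.ext j hc).symm⟩

/-- A pseudo-pullback has the colimits which its corners have, when they are preserved. -/
lemma exists_colimit {J : Type u₄} [Category.{v₄} J] [HasColimitsOfShape J A]
    [HasColimitsOfShape J S] [PreservesColimitsOfShape J G] [PreservesColimitsOfShape J K]
    (H : J ⥤ P) : ∃ c : Cocone H, Nonempty (IsColimit c) ∧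
      Nonempty (IsColimit (π.mapCocone c)) ∧ Nonempty (IsColimit (τ.mapCocone c)) := by
  let ca := colimit.isColimit (H ⋙ π)
  let cs := colimit.isColimit (H ⋙ τ)
  have hG := isColimitOfPreserves G ca
  have hK := isColimitOfPreserves K cs
  let ε : (H ⋙ π) ⋙ G ≅ (H ⋙ τ) ⋙ K := Functor.isoWhiskerLeft H e
  -- Both images are colimits of isomorphic diagrams in `B`, hence isomorphic; the object lifting
  -- this isomorphism carries the colimit.
  let θ : G.obj (colimit (H ⋙ π)) ≅ K.obj (colimit (H ⋙ τ)) :=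
    hG.coconePointsIsoOfNatIso hK ε
  have hθ (x : J) : G.map (colimit.ι (H ⋙ π) x) ≫ θ.hom =
      e.hom.app (H.obj x) ≫ K.map (colimit.ι (H ⋙ τ) x) :=
    hG.comp_coconePointsIsoOfNatIso_hom hK ε x
  obtain ⟨p, i, j, hp⟩ := h.lift_obj _ _ θ
  have hp' : G.map i.inv ≫ e.hom.app p = θ.hom ≫ K.map j.inv := by
    rw [← cancel_epi (G.map i.hom), ← Category.assoc, ← G.map_comp, Iso.hom_inv_id, G.map_id,
      Category.id_comp, ← Category.assoc, hp, Category.assoc, ← K.map_comp, Iso.hom_inv_id, K.map_id]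
    exact (Category.comp_id _).symm
  obtain ⟨ι, hι, hι'⟩ := h.exists_cocone (H := H) (p := p)
    (fun x => colimit.ι (H ⋙ π) x ≫ i.inv) (fun x => colimit.ι (H ⋙ τ) x ≫ j.inv)
    (fun {x y} f => by
      rw [← Category.assoc]
      exact congrArg (· ≫ i.inv) (colimit.w (H ⋙ π) f)) (fun x => by
      rw [G.map_comp, Category.assoc, hp', ← Category.assoc, hθ, K.map_comp]
      exact Category.assoc _ _ _)
  let c : Cocone H := ⟨p, ι⟩
  obtain ⟨h₁⟩ := isColimit_mapCocone_of_eq (Iso.refl _) (c := c) ca i fun x => by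
    refine (congrArg (· ≫ i.hom) (hι x)).trans ?_
    simp
  obtain ⟨h₂⟩ := isColimit_mapCocone_of_eq (Iso.refl _) (c := c) cs j fun x => by
    refine (congrArg (· ≫ j.hom) (hι' x)).trans ?_
    simp
  exact ⟨c, h.nonempty_isColimit h₁ h₂, ⟨h₁⟩, ⟨h₂⟩⟩

lemma hasDirectedColimits (hA : HasDirectedColimits.{w} A) (hS : HasDirectedColimits.{w} S)
    (hG : PreservesDirectedColimits.{w} G) (hK : PreservesDirectedColimits.{w} K) :
    HasDirectedColimits.{w} P := fun J _ _ _ => by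
  have := hA J
  have := hS J
  have := hG J
  have := hK J
  exact ⟨fun H => by
    obtain ⟨c, ⟨hc⟩, -⟩ := h.exists_colimit H
    exact ⟨c, hc⟩⟩

lemma preserves_fst (hA : HasDirectedColimits.{w} A) (hS : HasDirectedColimits.{w} S)
    (hG : PreservesDirectedColimits.{w} G) (hK : PreservesDirectedColimits.{w} K) :
    PreservesDirectedColimits.{w} π := fun J _ _ _ => by
  have := hA J
  have := hS J
  have := hG J
  have := hK J
  exact ⟨fun {H} => by
    obtain ⟨c, ⟨hc⟩, ⟨hc'⟩, -⟩ := h.exists_colimit H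
    exact preservesColimit_of_preserves_colimit_cocone hc hc'⟩

lemma preserves_snd (hA : HasDirectedColimits.{w} A) (hS : HasDirectedColimits.{w} S)
    (hG : PreservesDirectedColimits.{w} G) (hK : PreservesDirectedColimits.{w} K) :
    PreservesDirectedColimits.{w} τ := fun J _ _ _ => by
  have := hA J
  have := hS J
  have := hG J
  have := hK J
  exact ⟨fun {H} => by
    obtain ⟨c, ⟨hc⟩, -, ⟨hc'⟩⟩ := h.exists_colimit H
    exact preservesColimit_of_preserves_colimit_cocone hc hc'⟩

variable {lam : Cardinal.{w}} [Fact lam.IsRegular]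

/-- Both projections of a morphism into a filtered colimit factor through some stage. The two
factorizations become compatible in `B` at a later stage because `G.obj (π.obj p)` is presentable,
and the compatible pair lifts to `P`. -/
lemma isCardinalPresentable (hA : HasDirectedColimits.{w} A) (hS : HasDirectedColimits.{w} S)
    (hG : PreservesDirectedColimits.{w} G) (hK : PreservesDirectedColimits.{w} K) (p : P)
    (h₁ : IsCardinalPresentable (π.obj p) lam) (h₂ : IsCardinalPresentable (τ.obj p) lam)
    (h₃ : IsCardinalPresentable (G.obj (π.obj p)) lam) : IsCardinalPresentable p lam := by
  have := h.faithful_fst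
  apply isCardinalPresentable_of_factorization
  · intro J _ _ H c hc f
    have := isFiltered_of_isCardinalFiltered J lam
    have := (h.preserves_fst hA hS hG hK).preservesColimitsOfShape J
    have := (h.preserves_snd hA hS hG hK).preservesColimitsOfShape J
    have := hK.preservesColimitsOfShape J
    have hcπ := isColimitOfPreserves π hc
    have hcτ := isColimitOfPreserves τ hc
    have hcK := isColimitOfPreserves K hcτ
    obtain ⟨j₁, (a : π.obj p ⟶ π.obj (H.obj j₁)), (ha : a ≫ π.map (c.ι.app j₁) = π.map f)⟩ :=
      IsCardinalPresentable.exists_hom_of_isColimit lam hcπ (π.map f)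
    obtain ⟨j₂, (b : τ.obj p ⟶ τ.obj (H.obj j₂)), (hb : b ≫ τ.map (c.ι.app j₂) = τ.map f)⟩ :=
      IsCardinalPresentable.exists_hom_of_isColimit lam hcτ (τ.map f)
    obtain ⟨k, r, s, (hk : (G.map a ≫ e.hom.app (H.obj j₁)) ≫ K.map (τ.map (H.map r)) =
        (e.hom.app p ≫ K.map b) ≫ K.map (τ.map (H.map s)))⟩ :=
      IsCardinalPresentable.exists_eq_of_isColimit lam hcK
        (G.map a ≫ e.hom.app (H.obj j₁)) (e.hom.app p ≫ K.map b) (by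
          let q₁ : H.obj j₁ ⟶ c.pt := c.ι.app j₁
          let q₂ : H.obj j₂ ⟶ c.pt := c.ι.app j₂
          change (G.map a ≫ e.hom.app (H.obj j₁)) ≫ K.map (τ.map q₁) =
            (e.hom.app p ≫ K.map b) ≫ K.map (τ.map q₂)
          have n₁ : G.map (π.map q₁) ≫ e.hom.app c.pt =
            e.hom.app (H.obj j₁) ≫ K.map (τ.map q₁) := e.hom.naturality q₁
          have n₂ : G.map (π.map f) ≫ e.hom.app c.pt = e.hom.app p ≫ K.map (τ.map f) :=
            e.hom.naturality f
          have ha' : a ≫ π.map q₁ = π.map f := ha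
          have hb' : b ≫ τ.map q₂ = τ.map f := hb
          rw [Category.assoc, ← n₁, ← Category.assoc, ← G.map_comp, ha', n₂, ← hb', K.map_comp]
          exact (Category.assoc _ _ _).symm)
    obtain ⟨l, hl, -⟩ := h.exists_lift (a ≫ π.map (H.map r)) (b ≫ τ.map (H.map s)) (by
      have n : G.map (π.map (H.map r)) ≫ e.hom.app (H.obj k) =
        e.hom.app (H.obj j₁) ≫ K.map (τ.map (H.map r)) := e.hom.naturality (H.map r)
      rw [G.map_comp, Category.assoc, n, ← Category.assoc, hk, K.map_comp]
      exact Category.assoc _ _ _)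
    refine ⟨k, l, π.map_injective ?_⟩
    rw [π.map_comp, hl, ← ha, Category.assoc, ← π.map_comp]
    exact congrArg (fun t => a ≫ π.map t) (c.w r)
  · intro J _ _ H c hc j f g hfg
    have := isFiltered_of_isCardinalFiltered J lam
    have := (h.preserves_fst hA hS hG hK).preservesColimitsOfShape J
    obtain ⟨k, r, hr⟩ := IsCardinalPresentable.exists_eq_of_isColimit' lam
      (isColimitOfPreserves π hc) (π.map f) (π.map g) (by
        have := congrArg π.map hfg
        rwa [π.map_comp, π.map_comp] at this)
    refine ⟨k, r, π.map_injective ?_⟩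
    rw [π.map_comp, π.map_comp]
    exact hr

/-- The objects of a pseudo-pullback with presentable projections generate it. -/
theorem isCardinalFilteredGenerator (hlam : Cardinal.aleph0 < lam)
    (hA : HasDirectedColimits.{w} A) (hS : HasDirectedColimits.{w} S)
    (hG : PreservesDirectedColimits.{w} G) (hK : PreservesDirectedColimits.{w} K)
    {R : ObjectProperty A} {R' : ObjectProperty S} [R.IsClosedUnderIsomorphisms]
    [R'.IsClosedUnderIsomorphisms]
    (hR : R.IsCardinalFilteredGenerator lam) (hR' : R'.IsCardinalFilteredGenerator lam)
    (hRc : IsClosedUnderSmallDirectedColimits lam R)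
    (hRc' : IsClosedUnderSmallDirectedColimits lam R')
    (hRG : ∀ a, R a → IsCardinalPresentable (G.obj a) lam)
    (hRK : ∀ s, R' s → IsCardinalPresentable (K.obj s) lam) :
    (R.inverseImage π ⊓ R'.inverseImage τ).IsCardinalFilteredGenerator lam where
  le_isCardinalPresentable p hp := h.isCardinalPresentable hA hS hG hK p
    (hR.le_isCardinalPresentable _ hp.1) (hR'.le_isCardinalPresentable _ hp.2) (hRG _ hp.1)
  exists_colimitsOfShape p := by
    obtain ⟨W, _, _, ⟨x⟩, ⟨y⟩⟩ := hR.exists_common_poset hR' (π.obj p) (τ.obj p)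
    have := isFiltered_of_isCardinalFiltered W lam
    have := IsFiltered.isDirectedOrder W
    have := IsFiltered.nonempty (C := W)
    have := hG W
    have := hK W
    have hx (a : W) : IsCardinalPresentable ((x.diag ⋙ G).obj a) lam := hRG _ (x.prop_diag_obj a)
    have hy (a : W) : IsCardinalPresentable ((y.diag ⋙ K).obj a) lam := hRK _ (y.prop_diag_obj a)
    have hxc : IsColimit (G.mapCocone x.cocone) := isColimitOfPreserves G x.isColimit
    have hyc : IsColimit (K.mapCocone y.cocone) := isColimitOfPreserves K y.isColimit
    have e₁ : e.hom.app p ≫ e.inv.app p = 𝟙 _ := e.hom_inv_id_app p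
    have e₂ : e.inv.app p ≫ e.hom.app p = 𝟙 _ := e.inv_hom_id_app p
    obtain ⟨ub, hub⟩ := exists_upperBound_op W
    obtain ⟨M⟩ := IndexedMap.nonempty (cx := G.mapCocone x.cocone) hx hyc (e.hom.app p)
    obtain ⟨N⟩ := IndexedMap.nonempty (cx := K.mapCocone y.cocone) hy hxc (e.inv.app p)
    have hr := M.exists_eq_id hx hxc N e₁
    have hs := N.exists_eq_id hy hyc M e₂
    choose r hr using hr
    choose s hs using hs
    -- Besides upper bounds, a closed set must contain the indices that `M` and `N` use, and the
    -- indices `r`, `s` at which their composites become identities.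
    let Φ : W → W → Set W :=
      fun a b => {ub a b, M.idx a, M.bound a b, N.idx a, N.bound a b, r a, s a}
    have hΦ : ∀ a b, (Φ a b).Finite := fun a b => Set.toFinite _
    have hub' : ∀ a b, ∃ c ∈ Φ a b, a ≤ c ∧ b ≤ c := fun a b => ⟨ub a b, by simp [Φ], hub a b⟩
    have hM : ∀ a, M.idx a ∈ Φ a a := by simp [Φ]
    have hM' : ∀ a b, M.bound a b ∈ Φ a b := by simp [Φ]
    have hN : ∀ a, N.idx a ∈ Φ a a := by simp [Φ]
    have hN' : ∀ a b, N.bound a b ∈ Φ a b := by simp [Φ]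
    let X := SubcolimitDiagram.ofHasDirectedColimits lam hA hub' x.diag
    let Y := SubcolimitDiagram.ofHasDirectedColimits lam hS hub' y.diag
    let XG := X.map hub' G hG
    let YK := Y.map hub' K hK
    -- The isomorphism `e.hom.app p` thus restricts to every closed subset, so each pair of
    -- subcolimits underlies an object of `P`.
    let θ : X.diag ⋙ G ≅ Y.diag ⋙ K :=
      { hom := M.natTrans XG YK hM hM'
        inv := N.natTrans YK XG hN hN'
        hom_inv_id := M.natTrans_comp XG YK hM hM' N hN hN' fun a =>
          ⟨r a, by simp [Φ], hr a⟩
        inv_hom_id := N.natTrans_comp YK XG hN hN' M hM hM' fun a =>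
          ⟨s a, by simp [Φ], hs a⟩ }
    obtain ⟨H, i, j, hij⟩ := h.exists_functor X.diag Y.diag θ
    have hXG (U : SmallClosed lam Φ) :
        XG.leg (G.mapCocone x.cocone) U = G.map (X.leg x.cocone U) := XG.hom_ext fun a ha => by
      rw [XG.ι_leg]
      refine (congrArg G.map (X.ι_leg x.cocone U a ha)).symm.trans ?_
      exact G.map_comp _ _
    have hYK (U : SmallClosed lam Φ) :
        YK.leg (K.mapCocone y.cocone) U = K.map (Y.leg y.cocone U) := YK.hom_ext fun a ha => by
      rw [YK.ι_leg]
      refine (congrArg K.map (Y.ι_leg y.cocone U a ha)).symm.trans ?_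
      exact K.map_comp _ _
    have hθ (U : SmallClosed lam Φ) : θ.hom.app U ≫ K.map (Y.leg y.cocone U) =
        G.map (X.leg x.cocone U) ≫ e.hom.app p := by
      have := M.natTrans_leg XG YK hM hM' U
      rw [hXG, hYK] at this
      exact this
    obtain ⟨ι, hι, hι'⟩ := h.exists_cocone (H := H) (p := p)
      (fun U => i.hom.app U ≫ X.leg x.cocone U) (fun U => j.hom.app U ≫ Y.leg y.cocone U)
      (fun {U V} f => by
        rw [← X.diag_map_leg x.cocone f, ← Category.assoc, ← Category.assoc]
        exact congrArg (· ≫ X.leg x.cocone V) (i.hom.naturality f))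
      (fun U => by
        rw [G.map_comp, Category.assoc, ← hθ, ← Category.assoc, hij, K.map_comp]
        exact Category.assoc _ _ _)
    let c : Cocone H := ⟨p, ι⟩
    have : Nonempty W := inferInstance
    have hT := SmallClosed.isCardinalFiltered (lam := lam) (Φ := Φ) hlam hΦ
    have := isFiltered_of_isCardinalFiltered (SmallClosed lam Φ) lam
    have := hG.preservesColimitsOfShape (SmallClosed lam Φ)
    obtain ⟨h₁⟩ := isColimit_mapCocone_of_eq i (c := c) (X.isColimitCocone hlam hΦ x.isColimit)
      (Iso.refl _) fun U => (Category.comp_id _).trans (hι U)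
    obtain ⟨h₂⟩ := isColimit_mapCocone_of_eq j (c := c) (Y.isColimitCocone hlam hΦ y.isColimit)
      (Iso.refl _) fun U => (Category.comp_id _).trans (hι' U)
    obtain ⟨hc⟩ := h.nonempty_isColimit h₁ h₂
    exact ⟨SmallClosed lam Φ, inferInstance, hT,
      ⟨{ diag := H
         ι := c.ι
         isColimit := hc
         prop_diag_obj := fun U =>
          ⟨R.prop_of_iso (i.app U).symm (X.prop_obj hRc hub' x.prop_diag_obj U),
            R'.prop_of_iso (j.app U).symm (Y.prop_obj hRc' hub' y.prop_diag_obj U)⟩ }⟩⟩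

end IsPseudoPullback

end Pullback

/-! ### Local universality for left multiadjoints -/

section Multiadjoint

variable {𝒞 : Type u₁} [Category.{v₁} 𝒞] {𝒟 : Type u₂} [Category.{v₂} 𝒟] {F : 𝒞 ⥤ 𝒟}

variable (F) in
/-- A morphism `e : F X ⟶ D` through which every morphism `F B ⟶ D` connected to it factors
uniquely. -/
structure IsLocallyUniversal {X : 𝒞} {D : 𝒟} (e : F.obj X ⟶ D) : Prop where
  exists_lift {B C : 𝒞} (c : C ⟶ B) (b : F.obj B ⟶ D) (x : C ⟶ X) :
    F.map c ≫ b = F.map x ≫ e → ∃ y : B ⟶ X, F.map y ≫ e = b ∧ c ≫ y = x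
  hom_ext {B : 𝒞} (y y' : B ⟶ X) : F.map y ≫ e = F.map y' ≫ e → y = y'

namespace IsLeftMultiadjoint

/-- The member `e i` through which `a` factors is the required morphism. If `F.map c ≫ b = F.map x ≫
e i`, this morphism out of `F C` factors both through the member chosen for `b` and through `e i`;
uniqueness of the pair of index and lift identifies the two. -/
lemma exists_isLocallyUniversal (hF : IsLeftMultiadjoint F) {A : 𝒞} {D : 𝒟} (a : F.obj A ⟶ D) :
    ∃ (X : 𝒞) (e : F.obj X ⟶ D) (x : A ⟶ X), IsLocallyUniversal F e ∧ F.map x ≫ e = a := by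
  obtain ⟨ι, X, e, h⟩ := hF D
  obtain ⟨⟨i, x⟩, hx, -⟩ := h A a
  refine ⟨X i, e i, x, ⟨fun {B C} c b x hc => ?_, fun {B} y y' hy => ?_⟩, hx⟩
  · obtain ⟨⟨k, y⟩, hy, -⟩ := h B b
    obtain ⟨p, -, hp⟩ := h C (F.map c ≫ b)
    have h₁ := hp ⟨k, c ≫ y⟩ (by
      change F.map (c ≫ y) ≫ e k = _
      rw [F.map_comp, Category.assoc]
      exact congrArg (F.map c ≫ ·) hy)
    have h₂ := hp ⟨i, x⟩ hc.symm
    obtain ⟨rfl, hh⟩ := Sigma.mk.inj_iff.1 (h₁.trans h₂.symm)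
    exact ⟨y, hy, eq_of_heq hh⟩
  · obtain ⟨p, -, hp⟩ := h B (F.map y ≫ e i)
    have h₁ := hp ⟨i, y⟩ rfl
    have h₂ := hp ⟨i, y'⟩ hy.symm
    exact eq_of_heq (Sigma.mk.inj_iff.1 (h₁.trans h₂.symm)).2

/-- A left multiadjoint preserves directed colimits. -/
lemma preservesDirectedColimits (hF : IsLeftMultiadjoint F) : PreservesDirectedColimits.{w} F :=
  fun J _ _ _ => ⟨fun {H} => ⟨fun {c} hc => by
    have key (s : Cocone (H ⋙ F)) : ∃! m : F.obj c.pt ⟶ s.pt,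
        ∀ j, F.map (c.ι.app j) ≫ m = s.ι.app j := by
      obtain ⟨j₀⟩ := (inferInstance : Nonempty J)
      obtain ⟨X, e, x, he, hx⟩ := hF.exists_isLocallyUniversal (A := H.obj j₀) (s.ι.app j₀)
      -- An index `j` shares an upper bound `k` with `j₀`, so local universality passes from `j₀` to
      -- `k`, and restriction passes from `k` to `j`. Directedness thus selects one member of the
      -- family for the whole cocone.
      have hy (j : J) : ∃ y : H.obj j ⟶ X, F.map y ≫ e = s.ι.app j := by
        obtain ⟨k, h₀, hj⟩ := exists_ge_ge j₀ j
        obtain ⟨y, hy, -⟩ := he.exists_lift (B := H.obj k) (H.map (homOfLE h₀)) (s.ι.app k) x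
          ((s.w (homOfLE h₀)).trans hx.symm)
        refine ⟨H.map (homOfLE hj) ≫ y, ?_⟩
        rw [F.map_comp, Category.assoc]
        exact (congrArg (F.map (H.map (homOfLE hj)) ≫ ·) hy).trans (s.w (homOfLE hj))
      choose y hy using hy
      let t : Cocone H :=
        { pt := X
          ι :=
            { app := y
              naturality := fun j k f => by
                refine Eq.trans ?_ (Category.comp_id _).symm
                apply he.hom_ext
                rw [F.map_comp, Category.assoc]
                exact (congrArg (F.map (H.map f) ≫ ·) (hy k)).trans ((s.w f).trans (hy j).symm) } }
      have ht (j : J) : c.ι.app j ≫ hc.desc t = y j := hc.fac t j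
      refine ⟨F.map (hc.desc t) ≫ e, fun j => ?_, fun m hm => ?_⟩
      · refine (Category.assoc _ _ _).symm.trans ?_
        refine (congrArg (· ≫ e) ((F.map_comp _ _).symm.trans (congrArg F.map (ht j)))).trans (hy j)
      · obtain ⟨z, rfl, -⟩ := he.exists_lift (B := c.pt) (c.ι.app j₀) m (y j₀)
          ((hm j₀).trans (hy j₀).symm)
        have hz : z = hc.desc t := hc.uniq t z fun j => he.hom_ext _ _ (by
          rw [F.map_comp, Category.assoc]
          exact (hm j).trans (hy j).symm)
        rw [hz]
    choose m hm hu using key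
    exact ⟨{ desc := m, fac := hm, uniq := hu }⟩⟩⟩

end IsLeftMultiadjoint

end Multiadjoint

/-! ### Lifting the elementary properties and base monotonicity -/

namespace IndependenceRelation

/-- Completing the span over `C ⟶ B`, then over `B ⟶ D`, gives by transitivity an independent square
on the span of the given one. Uniqueness amalgamates the two, and invariance carries the second
completion into the amalgam. -/
lemma baseMonotonicity_of_uniqueness {𝒞 : Type u} [Category.{v} 𝒞] (I : IndependenceRelation 𝒞)
    (hi : I.Invariance) (ht : I.Transitivity) (he : I.Existence) (hu : I.Uniqueness) :
    I.BaseMonotonicity := by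
  intro C A B D M ca cb bd am dm h
  obtain ⟨A', aa', ba', h₁⟩ := he ca cb
  obtain ⟨N', an', dn', h₂⟩ := he ba' bd
  obtain ⟨N, mn, nn', e₁, e₂⟩ := hu _ _ _ _ _ _ h (ht _ _ _ _ _ _ _ h₁ h₂)
  refine ⟨A', N, aa', ba', an' ≫ nn', mn, I.comm h₁, ?_, ?_, ?_⟩
  · rw [e₁, Category.assoc]
  · rw [e₂, ← Category.assoc, I.comm h₂, Category.assoc]
  · rw [e₂]
    exact (hi _ _ _ _ _ (I.comm h₂)).1 h₂

section General

variable {𝒞 : Type u₁} [Category.{v₁} 𝒞] {𝒟 : Type u₂} [Category.{v₂} 𝒟] (F : 𝒞 ⥤ 𝒟)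
  {I : IndependenceRelation 𝒟}

lemma Invariance.lift (h : I.Invariance) : (I.lift F).Invariance := by
  intro C A B M N ca cb am bm mn hc
  have hc' : F.map ca ≫ F.map am = F.map cb ≫ F.map bm := by
    rw [← F.map_comp, hc, F.map_comp]
  have := h (F.map ca) (F.map cb) (F.map am) (F.map bm) (F.map mn) hc'
  constructor
  · rintro ⟨-, h'⟩
    refine ⟨by rw [← Category.assoc, hc, Category.assoc], ?_⟩
    rw [F.map_comp, F.map_comp]
    exact this.1 h'
  · rintro ⟨-, h'⟩
    rw [F.map_comp, F.map_comp] at h'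
    exact ⟨hc, this.2 h'⟩

lemma Monotonicity.lift (h : I.Monotonicity) : (I.lift F).Monotonicity := by
  rintro C A B' B M ca cb' b'b am bm ⟨hc, hind⟩
  refine ⟨by rw [hc, Category.assoc], ?_⟩
  rw [F.map_comp] at hind ⊢
  exact h _ _ _ _ _ hind

lemma Transitivity.lift (h : I.Transitivity) : (I.lift F).Transitivity := by
  rintro C A B M D N ca cb am bm bd mn dn ⟨hc, hind⟩ ⟨hc', hind'⟩
  refine ⟨by rw [← Category.assoc, hc, Category.assoc, hc', Category.assoc], ?_⟩
  rw [F.map_comp, F.map_comp]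
  exact h _ _ _ _ _ _ _ hind hind'

lemma Symmetry.lift (h : I.Symmetry) : (I.lift F).Symmetry := fun _ _ _ _ =>
  ⟨fun hi => ⟨hi.1.symm, (h _ _ _ _).1 hi.2⟩, fun hi => ⟨hi.1.symm, (h _ _ _ _).1 hi.2⟩⟩

lemma BasicExistence.lift (h : I.BasicExistence) : (I.lift F).BasicExistence := by
  intro C A B M ca cb am bm hc hiso
  refine ⟨hc, h _ _ _ _ (by rw [← F.map_comp, hc, F.map_comp]) ?_⟩
  rcases hiso with hi | hi
  · exact Or.inl inferInstance
  · exact Or.inr inferInstance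

/-- If `F` preserves joins of subobjects and all morphisms are monomorphisms, then base
monotonicity lifts along `F`. -/
lemma BaseMonotonicity.lift (hbm : I.BaseMonotonicity) (hi : I.Invariance) (hm : I.Monotonicity)
    (hs : I.Symmetry) (hC : ∀ {X Y : 𝒞} (f : X ⟶ Y), Mono f) (hD : ∀ {X Y : 𝒟} (f : X ⟶ Y), Mono f)
    (hjC : HasBinaryJoinsOfSubobjects 𝒞) (hjD : HasBinaryJoinsOfSubobjects 𝒟)
    (hF : PreservesBinaryJoinsOfSubobjects F) : (I.lift F).BaseMonotonicity := by
  rintro C A B D M ca cb bd am dm ⟨hc, hind⟩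
  rw [F.map_comp] at hind
  obtain ⟨A', N, aa', ba', a'n, mn, -, h₂, h₃, h₄⟩ := hbm _ _ _ _ _ hind
  have := @hC
  have := @hD
  -- The join of `A` and `B` inside `M` will play the role of `A'`, with `M` itself as the ambient
  -- object.
  obtain ⟨J, hJ⟩ := hjC M (Subobject.mk am) (Subobject.mk (bd ≫ dm))
  have hJ' : IsJoin am (bd ≫ dm) J.arrow :=
    ⟨inferInstance, inferInstance, inferInstance, by rwa [Subobject.mk_arrow]⟩
  have hFJ := (hF _ _ _ hJ').isLUB
  have hAJ : Subobject.mk am ≤ Subobject.mk J.arrow := by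
    rw [Subobject.mk_arrow]; exact hJ.1 (by simp)
  have hBJ : Subobject.mk (bd ≫ dm) ≤ Subobject.mk J.arrow := by
    rw [Subobject.mk_arrow]; exact hJ.1 (by simp)
  -- The image of `J` is least only among subobjects of `F.obj M`, whereas `A'` is a subobject of
  -- `N`. The join `K` in `N` lies in both, so it mediates: the image of `J` is below `K`, hence
  -- below `A'`.
  obtain ⟨K, hK⟩ := hjD N (Subobject.mk (F.map am ≫ mn)) (Subobject.mk (F.map (bd ≫ dm) ≫ mn))
  have hKm : K ≤ Subobject.mk mn := hK.2 (by
    rintro _ (rfl | rfl)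
    · exact Subobject.mk_le_mk_of_comm _ rfl
    · exact Subobject.mk_le_mk_of_comm _ rfl)
  have hKa : K ≤ Subobject.mk a'n := hK.2 (by
    rintro _ (rfl | rfl)
    · exact Subobject.mk_le_mk_of_comm aa' h₂
    · refine Subobject.mk_le_mk_of_comm ba' (h₃.trans ?_)
      rw [F.map_comp, Category.assoc])
  let k : (K : 𝒟) ⟶ F.obj M := Subobject.ofLEMk K mn hKm
  have hk : k ≫ mn = K.arrow := Subobject.ofLEMk_comp hKm
  have hle {Z : 𝒟} (z : Z ⟶ F.obj M) (hz : Subobject.mk (z ≫ mn) ≤ K) :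
      Subobject.mk z ≤ Subobject.mk k :=
    Subobject.mk_le_mk_of_comm (Subobject.ofMkLE _ K hz) (by
      rw [← cancel_mono mn, Category.assoc, hk]
      exact Subobject.ofMkLE_arrow hz)
  have hJk : Subobject.mk (F.map J.arrow) ≤ Subobject.mk k := hFJ.2 (by
    rintro _ (rfl | rfl)
    · exact hle _ (hK.1 (by simp))
    · exact hle _ (hK.1 (by simp)))
  let t : F.obj (J : 𝒞) ⟶ A' := Subobject.ofMkLEMk _ _ hJk ≫ Subobject.ofLEMk K a'n hKa
  have ht : t ≫ a'n = F.map J.arrow ≫ mn := by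
    simp only [t, Category.assoc, Subobject.ofLEMk_comp]
    rw [← hk, ← Category.assoc, Subobject.ofMkLEMk_comp]
  let bj : B ⟶ (J : 𝒞) := Subobject.ofMkLEMk _ _ hBJ
  have hbj : bj ≫ J.arrow = bd ≫ dm := Subobject.ofMkLEMk_comp hBJ
  have hbt : F.map bj ≫ t = ba' := by
    rw [← cancel_mono a'n, Category.assoc, ht, h₃, ← Category.assoc, ← F.map_comp, hbj,
      F.map_comp, Category.assoc]
  refine ⟨J, M, Subobject.ofMkLEMk _ _ hAJ, bj, J.arrow, 𝟙 M, ?_, ?_, ?_, ?_, ?_⟩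
  · rw [← cancel_mono J.arrow, Category.assoc, Category.assoc, hbj, Subobject.ofMkLEMk_comp, hc,
      Category.assoc]
  · rw [Subobject.ofMkLEMk_comp, Category.comp_id]
  · rw [hbj, Category.comp_id]
  · rw [hbj, Category.comp_id]
  · rw [Category.comp_id]
    -- Monotonicity shrinks the right-hand object only, so symmetry is used to replace `A'` by the
    -- image of `J`. Invariance then brings the square from `N` back to `F.obj M`.
    have h₅ := (hs _ _ _ _).1 h₄
    rw [← hbt] at h₅
    have h₆ := hm _ _ _ _ _ h₅
    rw [ht] at h₆
    refine (hs _ _ _ _).1 ((hi _ _ _ _ mn ?_).2 h₆)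
    rw [← F.map_comp, ← F.map_comp, hbj]

end General

/-! ### Lifting existence, uniqueness and amalgamation -/

section Classes

variable {𝒞 : Type u₁} [Category.{v₁} 𝒞] {𝒟 : Type u₂} [Category.{v₂} 𝒟] {F : 𝒞 ⥤ 𝒟}
  {ℳ : MorphismProperty 𝒟} [ℳ.IsMultiplicative] {I : IndependenceRelation (WideSubcategory ℳ)}

/-- Semi-invariance is applied along `e`, a morphism of `𝒟` only. This is why it is assumed on `𝒟`,
since invariance covers only morphisms in `ℳ`. -/
lemma lift_indep_of_comp (hI : I.extend.SemiInvariance)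
    {C A B X : WideSubcategory (ℳ.inverseImage F)} {M : WideSubcategory ℳ}
    (ca : C ⟶ A) (cb : C ⟶ B) (x : A ⟶ X) (y : B ⟶ X) (e : F.obj X.obj ⟶ M.obj)
    (hxy : ca ≫ x = cb ≫ y) {am : (restrictToClass F ℳ).obj A ⟶ M}
    {bm : (restrictToClass F ℳ).obj B ⟶ M}
    (ham : F.map x.hom ≫ e = am.hom) (hbm : F.map y.hom ≫ e = bm.hom)
    (h : I.Indep ((restrictToClass F ℳ).map ca) ((restrictToClass F ℳ).map cb) am bm) :
    (I.lift (restrictToClass F ℳ)).Indep ca cb x y := by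
  refine ⟨hxy, ?_⟩
  have hc : F.map ca.hom ≫ F.map x.hom = F.map cb.hom ≫ F.map y.hom := by
    rw [← F.map_comp, ← F.map_comp]
    exact congrArg (fun f => F.map f.hom) hxy
  obtain ⟨_, _, _, _, h'⟩ := hI (F.map ca.hom) (F.map cb.hom) (F.map x.hom) (F.map y.hom) e hc (by
    rw [ham, hbm]
    exact ⟨ca.property, cb.property, am.property, bm.property, h⟩)
  exact h'

section

variable (hF : IsLeftMultiadjoint F) (hℳ : LeftCancellable ℳ)

include hF hℳ

/-- Local universality restricted to the class: a lift `y` has `F.map y ≫ e` in `ℳ`, so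
left-cancellability puts `F.map y` in `ℳ`. Nothing is claimed about `e`. -/
lemma exists_factorization {A : WideSubcategory (ℳ.inverseImage F)} {M : WideSubcategory ℳ}
    (am : (restrictToClass F ℳ).obj A ⟶ M) :
    ∃ (X : WideSubcategory (ℳ.inverseImage F)) (e : F.obj X.obj ⟶ M.obj) (x : A ⟶ X),
      F.map x.hom ≫ e = am.hom ∧
      (∀ {B C : WideSubcategory (ℳ.inverseImage F)} (c : C ⟶ B)
        (b : (restrictToClass F ℳ).obj B ⟶ M) (z : C ⟶ X), F.map c.hom ≫ b.hom = F.map z.hom ≫ e →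
          ∃ y : B ⟶ X, F.map y.hom ≫ e = b.hom ∧ c ≫ y = z) ∧
      ∀ {B : WideSubcategory (ℳ.inverseImage F)} (y y' : B ⟶ X),
        F.map y.hom ≫ e = F.map y'.hom ≫ e → y = y' := by
  obtain ⟨X, e, x, he, hx⟩ := hF.exists_isLocallyUniversal (A := A.obj) am.hom
  refine ⟨⟨X⟩, e, ⟨x, hℳ _ e (by rw [hx]; exact am.property)⟩, hx, fun {B C} c b z hz => ?_,
    fun y y' hy => WideSubcategory.hom_ext _ (he.hom_ext _ _ hy)⟩
  obtain ⟨y, hy, hy'⟩ := he.exists_lift c.hom b.hom z.hom hz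
  exact ⟨⟨y, hℳ _ e (by rw [hy]; exact b.property)⟩, hy, WideSubcategory.hom_ext _ hy'⟩

/-- Commutativity over `C` connects the two sides of the square completed in `𝒟`, so both lift to
the same object. -/
lemma Existence.lift (h : I.Existence) (hI : I.extend.SemiInvariance) :
    (I.lift (restrictToClass F ℳ)).Existence := by
  intro C A B ca cb
  obtain ⟨M, am, bm, hind⟩ := h ((restrictToClass F ℳ).map ca) ((restrictToClass F ℳ).map cb)
  obtain ⟨X, e, x, hx, hl, -⟩ := exists_factorization hF hℳ am
  have hc : F.map ca.hom ≫ am.hom = F.map cb.hom ≫ bm.hom :=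
    congrArg (fun f => f.hom) (I.comm hind)
  obtain ⟨y, hy, hy'⟩ := hl cb bm (ca ≫ x) (by
    refine hc.symm.trans ?_
    rw [← hx]
    exact (Category.assoc _ _ _).symm.trans (congrArg (· ≫ e) (F.map_comp _ _).symm))
  exact ⟨X, x, y, lift_indep_of_comp hI ca cb x y e hy'.symm hx hy hind⟩

/-- The two morphisms to the amalgam are connected through `A`, so both lift to one object with
agreement on `A`; agreement on `B` follows from uniqueness of lifts. -/
lemma Uniqueness.lift (h : I.Uniqueness) : (I.lift (restrictToClass F ℳ)).Uniqueness := by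
  rintro C A B M M' ca cb am bm am' bm' ⟨-, h₁⟩ ⟨-, h₂⟩
  obtain ⟨N, mn, m'n, e₁, e₂⟩ := h _ _ _ _ _ _ h₁ h₂
  obtain ⟨X, e, x, hx, hl, hu⟩ := exists_factorization hF hℳ mn
  have heq₁ : F.map am.hom ≫ mn.hom = F.map am'.hom ≫ m'n.hom := congrArg (fun f => f.hom) e₁
  have heq₂ : F.map bm.hom ≫ mn.hom = F.map bm'.hom ≫ m'n.hom := congrArg (fun f => f.hom) e₂
  obtain ⟨y, hy, hy'⟩ := hl am' m'n (am ≫ x) (by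
    refine heq₁.symm.trans ?_
    rw [← hx]
    exact (Category.assoc _ _ _).symm.trans (congrArg (· ≫ e) (F.map_comp _ _).symm))
  refine ⟨X, x, y, hy'.symm, hu _ _ ?_⟩
  have map_comp {P Q R : WideSubcategory (ℳ.inverseImage F)} (p : P ⟶ Q) (q : Q ⟶ R) :
    F.map (p ≫ q).hom = F.map p.hom ≫ F.map q.hom := F.map_comp _ _
  rw [map_comp, map_comp, Category.assoc, Category.assoc, hx, hy, heq₂]

/-- The amalgam of three morphisms in `𝒟` which form a commuting cube may be replaced by one
in `𝒞`. -/
lemma exists_cube_factorization {A B C N₁ N₂ N₃ : WideSubcategory (ℳ.inverseImage F)}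
    {N : WideSubcategory ℳ}
    (an₁ : A ⟶ N₁) (bn₁ : B ⟶ N₁) (an₂ : A ⟶ N₂) (cn₂ : C ⟶ N₂) (bn₃ : B ⟶ N₃) (cn₃ : C ⟶ N₃)
    (n₁ : (restrictToClass F ℳ).obj N₁ ⟶ N) (n₂ : (restrictToClass F ℳ).obj N₂ ⟶ N)
    (n₃ : (restrictToClass F ℳ).obj N₃ ⟶ N)
    (ha : (restrictToClass F ℳ).map an₁ ≫ n₁ = (restrictToClass F ℳ).map an₂ ≫ n₂)
    (hb : (restrictToClass F ℳ).map bn₁ ≫ n₁ = (restrictToClass F ℳ).map bn₃ ≫ n₃)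
    (hc : (restrictToClass F ℳ).map cn₂ ≫ n₂ = (restrictToClass F ℳ).map cn₃ ≫ n₃) :
    ∃ (X : WideSubcategory (ℳ.inverseImage F)) (e : F.obj X.obj ⟶ N.obj)
      (x₁ : N₁ ⟶ X) (x₂ : N₂ ⟶ X) (x₃ : N₃ ⟶ X),
      F.map x₁.hom ≫ e = n₁.hom ∧ F.map x₂.hom ≫ e = n₂.hom ∧ F.map x₃.hom ≫ e = n₃.hom ∧
      an₁ ≫ x₁ = an₂ ≫ x₂ ∧ bn₁ ≫ x₁ = bn₃ ≫ x₃ ∧ cn₂ ≫ x₂ = cn₃ ≫ x₃ := by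
  obtain ⟨X, e, x₁, hx₁, hl, hu⟩ := exists_factorization hF hℳ n₁
  have map_comp {P Q R : WideSubcategory (ℳ.inverseImage F)} (p : P ⟶ Q) (q : Q ⟶ R) :
    F.map (p ≫ q).hom = F.map p.hom ≫ F.map q.hom := F.map_comp _ _
  have ha' : F.map an₁.hom ≫ n₁.hom = F.map an₂.hom ≫ n₂.hom := congrArg (fun f => f.hom) ha
  have hb' : F.map bn₁.hom ≫ n₁.hom = F.map bn₃.hom ≫ n₃.hom := congrArg (fun f => f.hom) hb
  have hc' : F.map cn₂.hom ≫ n₂.hom = F.map cn₃.hom ≫ n₃.hom := congrArg (fun f => f.hom) hc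
  -- The edges `n₂` and `n₃` are connected to `n₁` through `A` and `B`; commutation over `C` is then
  -- left to uniqueness of lifts.
  obtain ⟨x₂, hx₂, hax⟩ := hl an₂ n₂ (an₁ ≫ x₁) (by
    rw [map_comp, Category.assoc, hx₁, ha'])
  obtain ⟨x₃, hx₃, hbx⟩ := hl bn₃ n₃ (bn₁ ≫ x₁) (by
    rw [map_comp, Category.assoc, hx₁, hb'])
  exact ⟨X, e, x₁, x₂, x₃, hx₁, hx₂, hx₃, hax.symm, hbx.symm, hu _ _ (by
    rw [map_comp, map_comp, Category.assoc, Category.assoc, hx₂, hx₃, hc'])⟩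

lemma ThreeAmalgamation.lift (h : I.ThreeAmalgamation) (hI : I.extend.SemiInvariance) :
    (I.lift (restrictToClass F ℳ)).ThreeAmalgamation := by
  rintro M A B C N₁ N₂ N₃ ma mb mc an₁ bn₁ an₂ cn₂ bn₃ cn₃ ⟨h₁, h₂, h₃⟩
  obtain ⟨N, n₁, n₂, n₃, ha, hb, hc, hind⟩ := h _ _ _ _ _ _ _ _ _ ⟨h₁.2, h₂.2, h₃.2⟩
  obtain ⟨X, e, x₁, x₂, x₃, hx₁, hx₂, hx₃, ha', hb', hc'⟩ :=
    exists_cube_factorization hF hℳ an₁ bn₁ an₂ cn₂ bn₃ cn₃ n₁ n₂ n₃ ha hb hc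
  refine ⟨X, x₁, x₂, x₃, ha', hb', hc', lift_indep_of_comp hI _ _ _ _ e ?_ ?_ hx₃
    (am := (restrictToClass F ℳ).map an₁ ≫ n₁) ?_⟩
  · rw [← Category.assoc, h₁.1, Category.assoc, hb', Category.assoc]
  · refine (congrArg (· ≫ e) (F.map_comp _ _)).trans ((Category.assoc _ _ _).trans ?_)
    rw [hx₁]
    rfl
  · rw [Functor.map_comp]
    exact hind

lemma StrongThreeAmalgamation.lift (h : I.StrongThreeAmalgamation)
    (hI : I.extend.SemiInvariance) :
    (I.lift (restrictToClass F ℳ)).StrongThreeAmalgamation := by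
  rintro M A B C N₁ N₂ N₃ ma mb mc an₁ bn₁ an₂ cn₂ bn₃ cn₃ ⟨h₁, h₂, h₃⟩
  obtain ⟨N, n₁, n₂, n₃, ha, hb, hc⟩ := h _ _ _ _ _ _ _ _ _ ⟨h₁.2, h₂.2, h₃.2⟩
  obtain ⟨X, e, x₁, x₂, x₃, hx₁, hx₂, hx₃, ha', hb', hc'⟩ :=
    exists_cube_factorization hF hℳ an₁ bn₁ an₂ cn₂ bn₃ cn₃ n₁ n₂ n₃ (I.comm ha).symm (I.comm hb)
      (I.comm hc)
  exact ⟨X, x₁, x₂, x₃, lift_indep_of_comp hI _ _ _ _ e ha'.symm hx₂ hx₁ ha,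
    lift_indep_of_comp hI _ _ _ _ e hb' hx₁ hx₃ hb, lift_indep_of_comp hI _ _ _ _ e hc' hx₂ hx₃ hc⟩

end

end Classes

end IndependenceRelation

/-! ### Accessibility of arrow categories and pseudo-pullbacks -/

section Accessibility

lemma exists_isRegular_forall_le {ι : Type v} [Small.{w} ι] (κ : ι → Cardinal.{w}) :
    ∃ lam : Cardinal.{w}, lam.IsRegular ∧ Cardinal.aleph0 < lam ∧ ∀ i, κ i ≤ lam := by
  -- The summand `Unit` adds `Cardinal.aleph0` to the family, so `lam` is uncountable.
  obtain ⟨lam, h, h'⟩ := HasCardinalLT.exists_regular_cardinal_forall.{w}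
    (fun o : Unit ⊕ ι => (o.elim (fun _ => Cardinal.aleph0.{w}) κ).out)
  simp only [hasCardinalLT_iff_cardinal_mk_lt, Cardinal.mk_out] at h'
  exact ⟨lam, h, h' (Sum.inl ()), fun i => (h' (Sum.inr i)).le⟩

lemma HasDirectedColimits.hasCardinalFilteredColimits {A : Type u} [Category.{v} A]
    (hA : HasDirectedColimits.{w} A) (lam : Cardinal.{w}) [Fact lam.IsRegular] :
    HasCardinalFilteredColimits.{w} A lam where
  hasColimitsOfShape J _ _ := by
    have := isFiltered_of_isCardinalFiltered J lam
    exact hA.hasColimitsOfShape J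

instance {A : Type u} [Category.{v} A] [LocallySmall.{w} A] : LocallySmall.{w} (Arrow A) where
  hom_small f g := small_of_injective
    (f := fun q : f ⟶ g => ((q.left, q.right) : (f.left ⟶ g.left) × (f.right ⟶ g.right)))
    fun _ _ h => Arrow.hom_ext _ _ (congrArg Prod.fst h) (congrArg Prod.snd h)

/-- A class of objects is essentially small when its members are determined up to isomorphism by
data in a small type. -/
lemma CategoryTheory.ObjectProperty.essentiallySmall_of_relation {A : Type u} [Category.{v} A]
    {Q : ObjectProperty A} {T : Type u₁} [Small.{w} T] (rel : A → T → Prop)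
    (h₁ : ∀ X, Q X → ∃ t, rel X t) (h₂ : ∀ X Y t, rel X t → rel Y t → Nonempty (X ≅ Y)) :
    ObjectProperty.EssentiallySmall.{w} Q where
  exists_small_le' := by
    let f : { t : T // ∃ X, rel X t } → A := fun t => t.2.choose
    refine ⟨.ofObj f, inferInstance, fun X hX => ?_⟩
    obtain ⟨t, ht⟩ := h₁ X hX
    exact ⟨f ⟨t, X, ht⟩, ⟨_⟩, h₂ _ _ t ht (Exists.choose_spec (⟨X, ht⟩ : ∃ X, rel X t))⟩

lemma CategoryTheory.Arrow.essentiallySmall {A : Type u} [Category.{v} A] [LocallySmall.{w} A]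
    (R : ObjectProperty A) [ObjectProperty.EssentiallySmall.{w} R] :
    ObjectProperty.EssentiallySmall.{w}
      (R.inverseImage Arrow.leftFunc ⊓ R.inverseImage Arrow.rightFunc) := by
  obtain ⟨R₀, _, -, hR₀⟩ := ObjectProperty.EssentiallySmall.exists_small_le.{w} R
  refine ObjectProperty.essentiallySmall_of_relation
    (T := Σ a : Subtype R₀, Σ b : Subtype R₀, (a.1 ⟶ b.1))
    (fun f t => Nonempty (f ≅ Arrow.mk t.2.2)) (fun f hf => ?_)
    fun f g t ⟨i⟩ ⟨j⟩ => ⟨i ≪≫ j.symm⟩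
  obtain ⟨a, ha, ⟨i⟩⟩ := hR₀ _ hf.1
  obtain ⟨b, hb, ⟨j⟩⟩ := hR₀ _ hf.2
  exact ⟨⟨⟨a, ha⟩, ⟨b, hb⟩, i.inv ≫ f.hom ≫ j.hom⟩, ⟨Arrow.isoMk i j (Iso.hom_inv_id_assoc i (f.hom ≫ j.hom))⟩⟩

/-- Raises the index to `lam` while imposing a side condition `R`, later that a functor sends the
generators to presentable objects. Closing under small colimits provides the subcolimits and keeps
the objects presentable. -/
lemma CategoryTheory.ObjectProperty.IsCardinalFilteredGenerator.colimitsCardinalClosure_inf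
    {A : Type u} [Category.{v} A] [LocallySmall.{w} A]
    (hA : HasDirectedColimits.{w} A) {κ lam : Cardinal.{w}} [Fact κ.IsRegular] [Fact lam.IsRegular]
    (hlam : Cardinal.aleph0 < lam) (hκ : κ ≤ lam) {P R : ObjectProperty A}
    (hP : P.IsCardinalFilteredGenerator κ) (hPR : P ≤ R)
    (hR : IsClosedUnderSmallDirectedColimits lam R) :
    IsClosedUnderSmallDirectedColimits lam (P.colimitsCardinalClosure lam ⊓ R) ∧
      (P.colimitsCardinalClosure lam ⊓ R).IsCardinalFilteredGenerator lam := by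
  have h₁ : IsClosedUnderSmallDirectedColimits lam (P.colimitsCardinalClosure lam ⊓ R) :=
    IsClosedUnderSmallDirectedColimits.inf (fun J _ _ _ hJ =>
      P.isClosedUnderColimitsOfShape_colimitsCardinalClosure lam J
        (hasCardinalLT_arrow_of_preorder J hJ)) hR
  exact ⟨h₁, hP.of_le hA hlam (le_inf (P.le_colimitsCardinalClosure lam) hPR) h₁
    (inf_le_left.trans (P.colimitsCardinalClosure_le_isCardinalPresentable
      (hP.le_isCardinalPresentable.trans (isCardinalPresentable_monotone A hκ))))⟩

/-- The arrow category of an accessible category with directed colimits is accessible. -/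
theorem CategoryTheory.Arrow.isAccessibleCategory {A : Type u} [Category.{v} A]
    (hA : IsAccessibleCategory.{w} A) (hA' : HasDirectedColimits.{w} A) :
    IsAccessibleCategory.{w} (Arrow A) := by
  obtain ⟨κ, _, _⟩ := hA.exists_cardinal
  obtain ⟨P, _, hP⟩ := HasCardinalFilteredGenerator.exists_small_generator A κ
  obtain ⟨lam, hreg, hlam, hκ⟩ := exists_isRegular_forall_le fun _ : Unit => κ
  have : Fact lam.IsRegular := ⟨hreg⟩
  obtain ⟨h₁, h₂⟩ := hP.colimitsCardinalClosure_inf hA' hlam (hκ ()) (R := ⊤) le_top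
    (fun J _ _ _ _ => ⟨fun _ _ => trivial⟩)
  have := ObjectProperty.EssentiallySmall.of_le.{w}
    (inf_le_left : P.colimitsCardinalClosure lam ⊓ ⊤ ≤ P.colimitsCardinalClosure lam)
  have := Arrow.essentiallySmall.{w} (P.colimitsCardinalClosure lam ⊓ ⊤)
  have h₃ := Arrow.isCardinalFilteredGenerator hA' hlam h₂ h₁
  have := h₃.hasCardinalFilteredGenerator
  have := hA'.arrow.hasCardinalFilteredColimits lam
  exact ⟨lam, inferInstance, ⟨⟩⟩

/-- All objects of a small class are presentable at some common level. -/
lemma exists_cardinal_forall_isCardinalPresentable {A : Type u} [Category.{v} A] {B : Type u₁}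
    [Category.{v₁} B] [IsAccessibleCategory.{w} B] (P : ObjectProperty A)
    [ObjectProperty.Small.{w} P] (G : A ⥤ B) :
    ∃ κ : Cardinal.{w}, ∀ (lam : Cardinal.{w}) [Fact lam.IsRegular], κ ≤ lam →
      P ≤ (isCardinalPresentable B lam).inverseImage G := by
  have h (X : Subtype P) : ∃ (κ : Cardinal.{w}) (_ : Fact κ.IsRegular),
      IsCardinalPresentable (G.obj X.1) κ := (inferInstance : IsPresentable.{w} (G.obj X.1)).1
  choose κ hκ hκ' using h
  obtain ⟨κ₀, -, -, h₀⟩ := exists_isRegular_forall_le κ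
  exact ⟨κ₀, fun lam _ hlam X hX =>
    have := hκ' ⟨X, hX⟩
    isCardinalPresentable_of_le (G.obj X) ((h₀ ⟨X, hX⟩).trans hlam)⟩

namespace IsPseudoPullback

variable {P : Type u} [Category.{v} P] {A : Type u₁} [Category.{v₁} A]
  {S : Type u₂} [Category.{v₂} S] {B : Type u₃} [Category.{v₃} B]
  {π : P ⥤ A} {τ : P ⥤ S} {G : A ⥤ B} {K : S ⥤ B} {e : π ⋙ G ≅ τ ⋙ K}
  (h : IsPseudoPullback π τ G K e)

include h

/-- An object of the pseudo-pullback is determined up to isomorphism by its two projections and the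
comparison morphism between their images in `B`. -/
lemma essentiallySmall [LocallySmall.{w} B] (R : ObjectProperty A) (R' : ObjectProperty S)
    [ObjectProperty.EssentiallySmall.{w} R] [ObjectProperty.EssentiallySmall.{w} R'] :
    ObjectProperty.EssentiallySmall.{w} (R.inverseImage π ⊓ R'.inverseImage τ) := by
  obtain ⟨R₀, _, -, hR₀⟩ := ObjectProperty.EssentiallySmall.exists_small_le.{w} R
  obtain ⟨R₀', _, -, hR₀'⟩ := ObjectProperty.EssentiallySmall.exists_small_le.{w} R'
  refine ObjectProperty.essentiallySmall_of_relation
    (T := Σ a : Subtype R₀, Σ s : Subtype R₀', (G.obj a.1 ⟶ K.obj s.1))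
    (fun p t => ∃ (i : π.obj p ≅ t.1.1) (j : τ.obj p ≅ t.2.1.1),
      G.map i.inv ≫ e.hom.app p ≫ K.map j.hom = t.2.2) (fun p hp => ?_) ?_
  · obtain ⟨a, ha, ⟨i⟩⟩ := hR₀ _ hp.1
    obtain ⟨s, hs, ⟨j⟩⟩ := hR₀' _ hp.2
    exact ⟨⟨⟨a, ha⟩, ⟨s, hs⟩, G.map i.inv ≫ e.hom.app p ≫ K.map j.hom⟩, i, j, rfl⟩
  · have key (p q : P) (t : Σ a : Subtype R₀, Σ s : Subtype R₀', (G.obj a.1 ⟶ K.obj s.1))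
        (i : π.obj p ≅ t.1.1) (j : τ.obj p ≅ t.2.1.1) (i' : π.obj q ≅ t.1.1)
        (j' : τ.obj q ≅ t.2.1.1) (hp : G.map i.inv ≫ e.hom.app p ≫ K.map j.hom = t.2.2)
        (hq : G.map i'.inv ≫ e.hom.app q ≫ K.map j'.hom = t.2.2) :
        ∃ l : p ⟶ q, π.map l = i.hom ≫ i'.inv := by
      refine h.lift_hom _ (j.hom ≫ j'.inv) ?_
      rw [← cancel_epi (G.map i.inv), ← cancel_mono (K.map j'.hom)]
      have h₁ : G.map i.inv ≫ G.map (i.hom ≫ i'.inv) = G.map i'.inv := by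
        rw [← G.map_comp, Iso.inv_hom_id_assoc]
      have h₂ : K.map (j.hom ≫ j'.inv) ≫ K.map j'.hom = K.map j.hom := by
        rw [← K.map_comp, Category.assoc, Iso.inv_hom_id, Category.comp_id]
      refine Eq.trans ?_ ((hq.trans hp.symm).trans ?_)
      · rw [← h₁]
        simp only [Category.assoc]
      · rw [← h₂]
        simp only [Category.assoc]
    rintro p q t ⟨i, j, hp⟩ ⟨i', j', hq⟩
    obtain ⟨l, hl⟩ := key p q t i j i' j' hp hq
    obtain ⟨l', hl'⟩ := key q p t i' j' i j hq hp
    have := h.faithful_fst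
    exact ⟨⟨l, l', π.map_injective (by simp [hl, hl']), π.map_injective (by simp [hl, hl'])⟩⟩

/-- A pseudo-pullback of accessible categories with directed colimits, along functors preserving
directed colimits, is accessible. -/
theorem isAccessibleCategory (hA : IsAccessibleCategory.{w} A) (hS : IsAccessibleCategory.{w} S)
    (hB : IsAccessibleCategory.{w} B) (hA' : HasDirectedColimits.{w} A)
    (hS' : HasDirectedColimits.{w} S) (hG : PreservesDirectedColimits.{w} G)
    (hK : PreservesDirectedColimits.{w} K) : IsAccessibleCategory.{w} P := by
  obtain ⟨κA, _, _⟩ := hA.exists_cardinal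
  obtain ⟨PA, _, hPA⟩ := HasCardinalFilteredGenerator.exists_small_generator A κA
  obtain ⟨κS, _, _⟩ := hS.exists_cardinal
  obtain ⟨PS, _, hPS⟩ := HasCardinalFilteredGenerator.exists_small_generator S κS
  obtain ⟨κB, _, _⟩ := hB.exists_cardinal
  obtain ⟨κG, hκG⟩ := exists_cardinal_forall_isCardinalPresentable.{w} PA G
  obtain ⟨κK, hκK⟩ := exists_cardinal_forall_isCardinalPresentable.{w} PS K
  obtain ⟨lam, hreg, hlam, hκ⟩ := exists_isRegular_forall_le ![κA, κS, κG, κK]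
  have : Fact lam.IsRegular := ⟨hreg⟩
  have hBc := isClosedUnderSmallDirectedColimits_isCardinalPresentable B lam
  -- Generators must also have presentable images in `B`: representing the comparison isomorphism
  -- and its inverse by maps between terms needs this on both sides.
  let RG := (CategoryTheory.isCardinalPresentable B lam).inverseImage G
  let RK := (CategoryTheory.isCardinalPresentable B lam).inverseImage K
  obtain ⟨h₁, h₂⟩ := hPA.colimitsCardinalClosure_inf hA' hlam (show κA ≤ lam from hκ 0) (R := RG)
    (hκG lam (show κG ≤ lam from hκ 2)) (hBc.inverseImage hG)
  obtain ⟨h₃, h₄⟩ := hPS.colimitsCardinalClosure_inf hS' hlam (show κS ≤ lam from hκ 1) (R := RK)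
    (hκK lam (show κK ≤ lam from hκ 3)) (hBc.inverseImage hK)
  have := ObjectProperty.EssentiallySmall.of_le.{w}
    (inf_le_left : PA.colimitsCardinalClosure lam ⊓ RG ≤ PA.colimitsCardinalClosure lam)
  have := ObjectProperty.EssentiallySmall.of_le.{w}
    (inf_le_left : PS.colimitsCardinalClosure lam ⊓ RK ≤ PS.colimitsCardinalClosure lam)
  have h₅ := h.isCardinalFilteredGenerator hlam hA' hS' hG hK h₂ h₄ h₁ h₃
    (fun _ ha => ha.2) (fun _ hs => hs.2)
  have := h.essentiallySmall (PA.colimitsCardinalClosure lam ⊓ RG)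
    (PS.colimitsCardinalClosure lam ⊓ RK)
  have := h.faithful_fst
  have : LocallySmall.{w} P := locallySmall_of_faithful π
  have := h₅.hasCardinalFilteredGenerator
  have := (h.hasDirectedColimits hA' hS' hG hK).hasCardinalFilteredColimits lam
  exact ⟨lam, inferInstance, ⟨⟩⟩

end IsPseudoPullback

end Accessibility

/-! ### Directed colimits in the subcategory of a continuous class -/

section WideSubcategories

variable {𝒟 : Type u} [Category.{v} 𝒟] {ℳ : MorphismProperty 𝒟} [ℳ.IsMultiplicative]

/-- A cocone in the subcategory given by `ℳ` which is a colimit in `𝒟` is a colimit in the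
subcategory when the induced morphisms are in `ℳ`. -/
def isColimitOfWideSubcategory {J : Type u₁} [Category.{v₁} J] {G : J ⥤ WideSubcategory ℳ}
    {c : Cocone G} (hc : IsColimit ((wideSubcategoryInclusion ℳ).mapCocone c))
    (h : ∀ s : Cocone G, ℳ (hc.desc ((wideSubcategoryInclusion ℳ).mapCocone s))) :
    IsColimit c where
  desc s := ⟨hc.desc ((wideSubcategoryInclusion ℳ).mapCocone s), h s⟩
  fac s j := WideSubcategory.hom_ext _ (hc.fac ((wideSubcategoryInclusion ℳ).mapCocone s) j)
  uniq s m hm := WideSubcategory.hom_ext _ (hc.uniq ((wideSubcategoryInclusion ℳ).mapCocone s) m.hom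
    fun j => congrArg (fun f => f.hom) (hm j))

/-- Continuity places the coprojections and the induced morphisms of a colimit of `𝒟` in `ℳ`, so the
same cocone is a colimit in the subcategory. -/
lemma IsContinuousClass.exists_isColimit (h : IsContinuousClass.{w} ℳ)
    {J : Type w} [PartialOrder J] [IsDirectedOrder J] [Nonempty J] [HasColimitsOfShape J 𝒟]
    (G : J ⥤ WideSubcategory ℳ) : ∃ c : Cocone G, Nonempty (IsColimit c) ∧
      Nonempty (IsColimit ((wideSubcategoryInclusion ℳ).mapCocone c)) := by
  have hc := colimit.isColimit (G ⋙ wideSubcategoryInclusion ℳ)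
  obtain ⟨h₁, -⟩ := h J G _ hc
  let c : Cocone G :=
    { pt := ⟨colimit (G ⋙ wideSubcategoryInclusion ℳ)⟩
      ι :=
        { app := fun j => ⟨colimit.ι (G ⋙ wideSubcategoryInclusion ℳ) j, h₁ j⟩
          naturality := fun j k f => WideSubcategory.hom_ext _
            ((colimit.cocone (G ⋙ wideSubcategoryInclusion ℳ)).ι.naturality f) } }
  have hc' : IsColimit ((wideSubcategoryInclusion ℳ).mapCocone c) :=
    hc.ofIsoColimit (Cocone.ext (Iso.refl _) fun j => Category.comp_id _)
  exact ⟨c, ⟨isColimitOfWideSubcategory hc' (h J G _ hc').2⟩, ⟨hc'⟩⟩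

lemma IsContinuousClass.hasDirectedColimits (h : IsContinuousClass.{w} ℳ)
    (h𝒟 : HasDirectedColimits.{w} 𝒟) : HasDirectedColimits.{w} (WideSubcategory ℳ) :=
  fun J _ _ _ => by
    have := h𝒟 J
    exact ⟨fun G => by
      obtain ⟨c, ⟨hc⟩, -⟩ := h.exists_isColimit G
      exact ⟨c, hc⟩⟩

lemma IsContinuousClass.preservesDirectedColimits (h : IsContinuousClass.{w} ℳ)
    (h𝒟 : HasDirectedColimits.{w} 𝒟) :
    PreservesDirectedColimits.{w} (wideSubcategoryInclusion ℳ) := fun J _ _ _ => by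
  have := h𝒟 J
  exact ⟨fun {G} => by
    obtain ⟨c, ⟨hc⟩, ⟨hc'⟩⟩ := h.exists_isColimit G
    exact preservesColimit_of_preserves_colimit_cocone hc hc'⟩

/-- As `F` preserves the colimit, it sends coprojections to coprojections and induced morphisms to
induced morphisms, where continuity of `ℳ` applies. -/
lemma IsContinuousClass.inverseImage {𝒞 : Type u₁} [Category.{v₁} 𝒞] (h : IsContinuousClass.{w} ℳ)
    {F : 𝒞 ⥤ 𝒟} (hF : PreservesDirectedColimits.{w} F) :
    IsContinuousClass.{w} (ℳ.inverseImage F) := fun J _ _ _ G c hc => by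
  have := hF J
  have hFc := isColimitOfPreserves F hc
  obtain ⟨h₁, h₂⟩ := h J (G ⋙ restrictToClass F ℳ) (F.mapCocone c) hFc
  refine ⟨h₁, fun s => ?_⟩
  have := h₂ ((restrictToClass F ℳ).mapCocone s)
  have e : F.map (hc.desc ((wideSubcategoryInclusion (ℳ.inverseImage F)).mapCocone s)) =
      hFc.desc ((wideSubcategoryInclusion ℳ).mapCocone ((restrictToClass F ℳ).mapCocone s)) :=
    hFc.hom_ext fun j => (by
      refine Eq.trans ?_ (hFc.fac ((wideSubcategoryInclusion ℳ).mapCocone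
        ((restrictToClass F ℳ).mapCocone s)) j).symm
      exact (F.map_comp _ _).symm.trans (congrArg F.map (hc.fac _ j)))
  change ℳ (F.map _)
  rw [e]
  exact this

end WideSubcategories

/-! ### The category of lifted independent squares as a pseudo-pullback -/

namespace IndependenceRelation

variable {𝒞 : Type u₁} [Category.{v₁} 𝒞] {𝒟 : Type u₂} [Category.{v₂} 𝒟]

/-- The functor from the category of independent squares of the lift of a relation along `F`. -/
def liftSquares (F : 𝒞 ⥤ 𝒟) (I : IndependenceRelation 𝒟) (hb : I.BasicExistence)
    (ht : I.Transitivity) :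
    (I.lift F).SquareCategory (hb.lift F) (ht.lift F) ⥤ I.SquareCategory hb ht :=
  letI := I.squares_isMultiplicative hb ht
  letI := (I.lift F).squares_isMultiplicative (hb.lift F) (ht.lift F)
  { obj := fun f => ⟨F.mapArrow.obj f.obj⟩
    map := fun q => ⟨F.mapArrow.map q.hom, q.property.2⟩
    map_id := fun f => WideSubcategory.hom_ext _ (F.mapArrow.map_id f.obj)
    map_comp := fun p q => WideSubcategory.hom_ext _ (F.mapArrow.map_comp p.hom q.hom) }

variable {F : 𝒞 ⥤ 𝒟} {ℳ : MorphismProperty 𝒟} [ℳ.IsMultiplicative]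
  {I : IndependenceRelation (WideSubcategory ℳ)}

/-- The category of independent squares, as a non-full subcategory of the arrows of `𝒟`. -/
abbrev squareForget (I : IndependenceRelation (WideSubcategory ℳ)) (hb : I.BasicExistence)
    (ht : I.Transitivity) : I.SquareCategory hb ht ⥤ Arrow 𝒟 :=
  I.squareInclusion hb ht ⋙ (wideSubcategoryInclusion ℳ).mapArrow

/-- A lifted independent square is a commuting square of `𝒞` with an independent image. Working over
`Arrow 𝒟` rather than over arrows in `ℳ` means that accessibility of the subcategory of `𝒞` is not
needed. Closure of `ℳ` under isomorphisms is what lets objects lift. -/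
lemma isPseudoPullback_lift (_ : F.Faithful) (hℳ : MorphismProperty.isomorphisms 𝒟 ≤ ℳ)
    (hb : I.BasicExistence) (ht : I.Transitivity) :
    IsPseudoPullback
      ((I.lift (restrictToClass F ℳ)).squareForget (hb.lift _) (ht.lift _))
      (liftSquares (restrictToClass F ℳ) I hb ht) F.mapArrow (I.squareForget hb ht)
      (Iso.refl _) where
  faithful_fst := ⟨fun {f g} p q hpq => by
    let := (I.lift (restrictToClass F ℳ)).squares_isMultiplicative (hb.lift _) (ht.lift _)
    exact WideSubcategory.hom_ext _ (Arrow.hom_ext _ _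
      (WideSubcategory.hom_ext _ (congrArg Arrow.Hom.left hpq))
      (WideSubcategory.hom_ext _ (congrArg Arrow.Hom.right hpq)))⟩
  faithful_right := ⟨fun {f g} p q hpq => by
    let := I.squares_isMultiplicative hb ht
    exact WideSubcategory.hom_ext _ (Arrow.hom_ext _ _
      (WideSubcategory.hom_ext _ (congrArg Arrow.Hom.left hpq))
      (WideSubcategory.hom_ext _ (congrArg Arrow.Hom.right hpq)))⟩
  lift_hom {p q} f g hfg := by
    let := I.squares_isMultiplicative hb ht
    let := (I.lift (restrictToClass F ℳ)).squares_isMultiplicative (hb.lift _) (ht.lift _)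
    have hfg' : F.mapArrow.map f = (I.squareForget hb ht).map g :=
      (Category.comp_id _).symm.trans (hfg.trans (Category.id_comp _))
    have hl : F.map f.left = g.hom.left.hom := congrArg Arrow.Hom.left hfg'
    have hr : F.map f.right = g.hom.right.hom := congrArg Arrow.Hom.right hfg'
    let l : p.obj.left ⟶ q.obj.left := ⟨f.left, by
      change ℳ (F.map f.left)
      rw [hl]
      exact g.hom.left.property⟩
    let r : p.obj.right ⟶ q.obj.right := ⟨f.right, by
      change ℳ (F.map f.right)
      rw [hr]
      exact g.hom.right.property⟩
    have hlr : l ≫ q.obj.hom = p.obj.hom ≫ r := WideSubcategory.hom_ext _ f.w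
    have hl' : (restrictToClass F ℳ).map l = g.hom.left := WideSubcategory.hom_ext _ hl
    have hr' : (restrictToClass F ℳ).map r = g.hom.right := WideSubcategory.hom_ext _ hr
    refine ⟨⟨Arrow.homMk l r hlr, hlr.symm, ?_⟩, rfl⟩
    change I.Indep _ ((restrictToClass F ℳ).map l) ((restrictToClass F ℳ).map r) _
    rw [hl', hr']
    exact g.property
  lift_obj a s θ := by
    let := (I.lift (restrictToClass F ℳ)).squares_isMultiplicative (hb.lift _) (ht.lift _)
    let := I.squares_isMultiplicative hb ht
    let θl : F.obj a.left ≅ s.obj.left.obj := Arrow.leftFunc.mapIso θ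
    let θr : F.obj a.right ≅ s.obj.right.obj := Arrow.rightFunc.mapIso θ
    have hθ : θl.hom ≫ s.obj.hom.hom = F.map a.hom ≫ θr.hom := θ.hom.w
    have ha : ℳ (F.map a.hom) := by
      have : F.map a.hom = θl.hom ≫ s.obj.hom.hom ≫ θr.inv := by
        rw [← Category.assoc, hθ, Category.assoc, Iso.hom_inv_id, Category.comp_id]
      rw [this]
      exact ℳ.comp_mem _ _ (hℳ _ (inferInstanceAs (IsIso θl.hom)))
        (ℳ.comp_mem _ _ s.obj.hom.property (hℳ _ (inferInstanceAs (IsIso θr.inv))))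
    let a' : Arrow (WideSubcategory (ℳ.inverseImage F)) :=
      Arrow.mk (X := ⟨a.left⟩) (Y := ⟨a.right⟩) ⟨a.hom, ha⟩
    let l : (restrictToClass F ℳ).obj ⟨a.left⟩ ≅ s.obj.left :=
      WideSubcategory.isoMk θl (hℳ _ (inferInstanceAs (IsIso θl.hom)))
        (hℳ _ (inferInstanceAs (IsIso θl.inv)))
    let r : (restrictToClass F ℳ).obj ⟨a.right⟩ ≅ s.obj.right :=
      WideSubcategory.isoMk θr (hℳ _ (inferInstanceAs (IsIso θr.hom)))
        (hℳ _ (inferInstanceAs (IsIso θr.inv)))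
    let j : (restrictToClass F ℳ).mapArrow.obj a' ≅ s.obj :=
      Arrow.isoMk l r (WideSubcategory.hom_ext _ hθ)
    refine ⟨⟨a'⟩, Iso.refl _, WideSubcategory.isoMk j ?_ ?_, ?_⟩
    -- An isomorphism of arrows, in either direction, is an independent square by basic existence,
    -- its bottom side being invertible.
    · exact hb _ _ _ _ j.hom.w.symm (Or.inr (inferInstanceAs (IsIso l.hom)))
    · exact hb _ _ _ _ j.inv.w.symm (Or.inr (inferInstanceAs (IsIso l.inv)))
    · refine (congrArg (· ≫ θ.hom) (F.mapArrow.map_id a)).trans ?_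
      exact (Category.id_comp _).trans (Category.id_comp _).symm

lemma preservesDirectedColimits_squareForget (h𝒟 : HasDirectedColimits.{w} 𝒟)
    (hℳ : IsContinuousClass.{w} ℳ) {hb : I.BasicExistence} {ht : I.Transitivity}
    (hI : PreservesDirectedColimits.{w} (I.squareInclusion hb ht)) :
    PreservesDirectedColimits.{w} (I.squareForget hb ht) :=
  hI.comp (PreservesDirectedColimits.mapArrow (hℳ.hasDirectedColimits h𝒟)
    (hℳ.preservesDirectedColimits h𝒟))

/-- The pseudo-pullback gives directed colimits that are preserved into `Arrow 𝒞`. Continuity of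
`F⁻¹(ℳ)` shows that sources and targets are already colimits in the subcategory, so preservation
holds for its arrow category. -/
lemma Union.lift (hI : Union.{w} I) (h𝒞 : HasDirectedColimits.{w} 𝒞)
    (h𝒟 : HasDirectedColimits.{w} 𝒟) (hF : F.Faithful) (hF' : PreservesDirectedColimits.{w} F)
    (hℳ : MorphismProperty.isomorphisms 𝒟 ≤ ℳ) (hℳ' : IsContinuousClass.{w} ℳ) :
    Union.{w} (I.lift (restrictToClass F ℳ)) := by
  obtain ⟨hb, ht, hS, hS'⟩ := hI
  have h := isPseudoPullback_lift hF hℳ hb ht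
  have hG := PreservesDirectedColimits.mapArrow h𝒞 hF'
  have hK := preservesDirectedColimits_squareForget h𝒟 hℳ' hS'
  refine ⟨hb.lift _, ht.lift _, h.hasDirectedColimits h𝒞.arrow hS hG hK, fun J _ _ _ => ?_⟩
  have hN := hℳ'.inverseImage hF'
  have := h.preserves_fst h𝒞.arrow hS hG hK J
  have := h𝒞.preserves_leftFunc J
  have := h𝒞.preserves_rightFunc J
  refine ⟨fun {H} => ⟨fun {c} hc => ⟨Arrow.isColimitOfLeftRight ?_ ?_⟩⟩⟩
  all_goals
    have hc' := isColimitOfPreserves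
      ((I.lift (restrictToClass F ℳ)).squareForget (hb.lift _) (ht.lift _)) hc
  · have hl : IsColimit ((wideSubcategoryInclusion (ℳ.inverseImage F)).mapCocone
        (Arrow.leftFunc.mapCocone
          (((I.lift (restrictToClass F ℳ)).squareInclusion (hb.lift _) (ht.lift _)).mapCocone c))) :=
      isColimitOfPreserves Arrow.leftFunc hc'
    exact isColimitOfWideSubcategory hl (hN J _ _ hl).2
  · have hr : IsColimit ((wideSubcategoryInclusion (ℳ.inverseImage F)).mapCocone
        (Arrow.rightFunc.mapCocone
          (((I.lift (restrictToClass F ℳ)).squareInclusion (hb.lift _) (ht.lift _)).mapCocone c))) :=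
      isColimitOfPreserves Arrow.rightFunc hc'
    exact isColimitOfWideSubcategory hr (hN J _ _ hr).2

lemma Accessible.lift (hI : Accessible.{w} I) (hI' : Union.{w} I)
    (h𝒞 : IsAccessibleCategory.{w} 𝒞) (h𝒞' : HasDirectedColimits.{w} 𝒞)
    (h𝒟 : IsAccessibleCategory.{w} 𝒟) (h𝒟' : HasDirectedColimits.{w} 𝒟) (hF : F.Faithful)
    (hF' : PreservesDirectedColimits.{w} F)
    (hℳ : MorphismProperty.isomorphisms 𝒟 ≤ ℳ) (hℳ' : IsContinuousClass.{w} ℳ) :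
    Accessible.{w} (I.lift (restrictToClass F ℳ)) := by
  obtain ⟨hb, ht, hacc⟩ := hI
  obtain ⟨_, _, hS, hS'⟩ := hI'
  exact ⟨hb.lift _, ht.lift _, (isPseudoPullback_lift hF hℳ hb ht).isAccessibleCategory
    (Arrow.isAccessibleCategory h𝒞 h𝒞') hacc (Arrow.isAccessibleCategory h𝒟 h𝒟') h𝒞'.arrow hS
    (PreservesDirectedColimits.mapArrow h𝒞' hF')
    (preservesDirectedColimits_squareForget h𝒟' hℳ' hS')⟩

end IndependenceRelation

/-! ### Assembling the three statements -/

theorem mainTheorem2 {𝒞 : Type u₁} [Category.{v₁} 𝒞] {𝒟 : Type u₂} [Category.{v₂} 𝒟]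
    (h𝒞 : IsAccessibleCategory.{w} 𝒞) (h𝒞' : HasDirectedColimits.{w} 𝒞)
    (h𝒟 : IsAccessibleCategory.{w} 𝒟) (h𝒟' : HasDirectedColimits.{w} 𝒟)
    (F : 𝒞 ⥤ 𝒟) (hF : F.Faithful) (hF' : IsLeftMultiadjoint F)
    -- a composable, left-cancellable, accessible and continuous class of monomorphisms
    (ℳ : MorphismProperty 𝒟) [ℳ.IsMultiplicative] (hℳ_iso : MorphismProperty.isomorphisms 𝒟 ≤ ℳ)
    (hℳ_mono : ℳ ≤ MorphismProperty.monomorphisms 𝒟) (hℳ_cancel : LeftCancellable ℳ)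
    (hℳ_acc : IsAccessibleCategory.{w} (WideSubcategory ℳ))
    (hℳ_cont : IsContinuousClass.{w} ℳ)
    (I : IndependenceRelation (WideSubcategory ℳ)) (hI : I.extend.SemiInvariance) :
    (IndependenceRelation.IsStable.{w} I →
      IndependenceRelation.IsStable.{w} (I.lift (restrictToClass F ℳ))) ∧
    (IndependenceRelation.IsSimple.{w} I →
      HasBinaryJoinsOfSubobjects (WideSubcategory (ℳ.inverseImage F)) →
      HasBinaryJoinsOfSubobjects (WideSubcategory ℳ) →
      PreservesBinaryJoinsOfSubobjects (restrictToClass F ℳ) →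
      IndependenceRelation.IsSimple.{w} (I.lift (restrictToClass F ℳ))) ∧
    (IndependenceRelation.IsNSOP1Like.{w} I →
      IndependenceRelation.IsNSOP1Like.{w} (I.lift (restrictToClass F ℳ)) ∧
      (I.StrongThreeAmalgamation →
        (I.lift (restrictToClass F ℳ)).StrongThreeAmalgamation)) := by
  have hFd : PreservesDirectedColimits.{w} F := hF'.preservesDirectedColimits
  have nsop (h : IndependenceRelation.IsNSOP1Like.{w} I) :
      IndependenceRelation.IsNSOP1Like.{w} (I.lift (restrictToClass F ℳ)) :=
    { accessible := h.accessible.lift h.union h𝒞 h𝒞' h𝒟 h𝒟' hF hFd hℳ_iso hℳ_cont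
      invariance := IndependenceRelation.Invariance.lift _ h.invariance
      monotonicity := IndependenceRelation.Monotonicity.lift _ h.monotonicity
      transitivity := IndependenceRelation.Transitivity.lift _ h.transitivity
      symmetry := IndependenceRelation.Symmetry.lift _ h.symmetry
      existence := IndependenceRelation.Existence.lift hF' hℳ_cancel h.existence hI
      threeAmalgamation := IndependenceRelation.ThreeAmalgamation.lift hF' hℳ_cancel h.threeAmalgamation hI
      union := h.union.lift h𝒞' h𝒟' hF hFd hℳ_iso hℳ_cont }
  refine ⟨fun h => ?_, fun h hj𝒞 hj𝒟 hFj => ?_, fun h => ⟨nsop h, fun h' =>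
    IndependenceRelation.StrongThreeAmalgamation.lift hF' hℳ_cancel h' hI⟩⟩
  · have h' := nsop h.toIsNSOP1Like
    have hu : (I.lift (restrictToClass F ℳ)).Uniqueness :=
      IndependenceRelation.Uniqueness.lift hF' hℳ_cancel h.uniqueness
    -- No joins are available here, so base monotonicity is derived from the lifted uniqueness
    -- instead of being lifted.
    exact ⟨⟨h', IndependenceRelation.baseMonotonicity_of_uniqueness _ h'.invariance
      h'.transitivity h'.existence hu⟩, hu⟩
  · refine ⟨nsop h.toIsNSOP1Like,
      IndependenceRelation.BaseMonotonicity.lift _ h.baseMonotonicity h.invariance h.monotonicity h.symmetry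
      -- Faithfulness of `F` reflects monomorphisms, so every morphism in `F⁻¹(ℳ)` is one.
      (fun {X Y} f => ⟨fun g g' hg => WideSubcategory.hom_ext _ (F.map_injective ?_)⟩)
      (fun {X Y} f => ⟨fun g g' hg => WideSubcategory.hom_ext _ ?_⟩) hj𝒞 hj𝒟 hFj⟩
    · have : Mono (F.map f.hom) := hℳ_mono _ f.property
      rw [← cancel_mono (F.map f.hom), ← F.map_comp, ← F.map_comp]
      exact congrArg (fun q => F.map q.hom) hg
    · have : Mono f.hom := hℳ_mono _ f.property
      rw [← cancel_mono f.hom]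
      exact congrArg (fun q => q.hom) hg
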